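/- **Definitions.** All complexes are simplicial complexes with the weak topology. Let $f:X\to N$ be a simplicial map which is *non-degenerate* (injective on each simplex). Put $(x_1,x_2)\in\Phi(f)\iff f(x_1)=f(x_2)$. An equivalence relation $R$ on $X$ is *$f$-admissible* if, whenever $\sigma_1,\sigma_2$ are simplices of the same dimension with $f(\sigma_1)=f(\sigma_2)$ and $(x_1,x_2)\in R$ for some $x_i\in\mathrm{int}\,\sigma_i$ with $f(x_1)=f(x_2)$, then $R$ identifies $\sigma_1$ with $\sigma_2$ compatibly with $f$. $\Psi(f)$ is the smallest $f$-admissible equivalence relation $R\subset\Phi(f)$ such that the induced map $X/R\to N$ is locally injective at every point. A complex $K$ is *gsc* if its simplices can be organized as $K=T\cup\sum_i H^1_i\cup\sum_j H^2_j\cup\{\text{other simplices, of dimension}\ge 2\}$, where $T$ is a tree containing all vertices, the edges $H^1_i$ are all the edges outside $T$, the 2-simplices $H^2_j$ are indexed by the same subset of $\mathbb N$, and the number of times that $\partial H^2_j$ goes through $H^1_i$ is $\delta_{ji}+a_{ji}$ with $a_{ji}\ge 0$ and $a_{ji}>0\Rightarrow j>i$. A subcomplex $L$ of $K$ is a *gsc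 subcomplex* if there is such a decomposition of $K$ for which $T\cap L$ is a tree containing all vertices of $L$, and $H^1_i\subset L$ implies $H^2_i\subset L$. A *three-dimensional representation* is a non-degenerate simplicial map $f:X\to N$ where $X$ is countable, 3-dimensional and gsc, $\Psi(f)=\Phi(f)$, and $f$ is essentially surjective, i.e. $\overline{f(X)}=N$. **Setting.** Let $G$ be a group and $M=M^3(G)$ a good presentation of $G$: a finite 3-dimensional complex with an isomorphism $G\cong\pi_1(M)$, which is a union of finitely many gsc subcomplexes (pieces) $\Delta_i$, glued along finitely many subcomplexes (faces) $g_a$. Each $g_a$ is contained in two different given pieces, and is a full gsc subcomplex of each of them; and if a simplex belongs to two pieces, these are joined by a chain of pieces in which consecutive ones are glued along a face containing the simplex. Choose a set of faces along which all the pieces are joined in the pattern of a tree, and let $\Delta$ be the arborescent union of the $\Delta_i$ along these faces (the fundamental domain). Each of the remaining faces gives two free faces of $\Delta$; let $\Sigma$ be the set of these free faces, with the fixed point free involution $j$ exchanging the two. Let $\overline G$ be the free monoid on $\Sigma$ modulo $\overline g\cdot j\overline g=j\overline g\cdot\overline g=1$ (a free group), and let $X^3$ be the quotient of $\sum_{x\in\overline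 G}x\Delta$ obtained by gluing the face $\overline g$ of $x\Delta$ to the face $j\overline g$ of $x\overline g\Delta$, for all $x\in\overline G$, $\overline g\in\Sigma$. Let $F:X^3\to M$ be the tautological map, $\overline G$ act on $X^3$ by $y\cdot x\Delta=yx\Delta$, and $\pi:\widetilde M\to M$ be the universal covering (a simplicial map), with the natural action of $G\cong\pi_1(M)$ by deck transformations. Fix a simplicial lift $s:\Delta\to\widetilde M$ of $\Delta\to M$, and a point $b$ of $\Delta$; the base points of $M$ and $\widetilde M$ are the image of $b$ and $s(b)$. **Lemma 7.** There is exactly one simplicial map $f:X^3\to\widetilde M$ with $\pi\circ f=F$ and $f|_{1\cdot\Delta}=s$ (the canonical lift), and $f$ is a three-dimensional representation: $X^3$ is gsc, $f$ is non-degenerate and essentially surjective, and $\Psi(f)=\Phi(f)$. Moreover let $\chi$ send $y\in\overline G$ to the element of $G\cong\pi_1(M)$ which is the class of the loop $F\circ\delta$, where $\delta$ is any path in $X^3$ from the point $b$ of $1\cdot\Delta$ to the point $b$ of $y\Delta$. Then $\chi:\overline G\to G$ is a well-defined surjective homomorphism, and $f(y\cdot x)=\chi(y)\cdot f(x)$ for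 all $y\in\overline G$, $x\in X^3$. -/

import Mathlib

noncomputable section

/-! ### Simplicial complexes, their realizations, simplicial maps -/

/-- The space of an abstract simplicial complex: points are given by barycentric coordinates. -/
@[ext]
structure Realization {V : Type*} (K : AbstractSimplicialComplex V) where
  weight : V →₀ ℝ
  support_mem : weight.support ∈ K.faces
  nonneg : ∀ v, 0 ≤ weight v
  sum_eq_one : (weight.sum fun _ t => t) = 1

/-- The simplex that contains the point `x` in its interior. -/
def Realization.carrier {V : Type*} {K : AbstractSimplicialComplex V} (x : Realization K) :
    Finset V := x.weight.support

/-- The weak topology: a set is open iff its trace on every closed simplex is open, each closed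
simplex carrying the topology of its barycentric coordinates. -/
instance Realization.topology {V : Type*} (K : AbstractSimplicialComplex V) :
    TopologicalSpace (Realization K) :=
  ⨆ σ : K.faces, TopologicalSpace.coinduced
    (Subtype.val : {x : Realization K // x.carrier ⊆ σ.1} → Realization K)
    (TopologicalSpace.induced (fun x (v : V) => x.1.weight v) inferInstance)

open Classical in
/-- Simplicial maps. -/
@[ext]
structure SimplicialMap {V W : Type*} (K : AbstractSimplicialComplex V)
    (L : AbstractSimplicialComplex W) where
  toFun : V → W
  map_faces : ∀ σ ∈ K.faces, σ.image toFun ∈ L.faces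

instance {V W : Type*} (K : AbstractSimplicialComplex V) (L : AbstractSimplicialComplex W) :
    CoeFun (SimplicialMap K L) (fun _ => V → W) := ⟨SimplicialMap.toFun⟩

namespace SimplicialMap

variable {V W : Type*} {K : AbstractSimplicialComplex V} {L : AbstractSimplicialComplex W}

open Classical in
/-- The map of spaces induced by a simplicial map (affine on every simplex). -/
def real (f : SimplicialMap K L) (x : Realization K) : Realization L :=
  have hsum : ((x.weight.mapDomain f).sum fun _ t => t) = 1 := by
    rw [Finsupp.sum_mapDomain_index (fun _ => rfl) (fun _ _ _ => rfl)]
    exact x.sum_eq_one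
  { weight := x.weight.mapDomain f
    support_mem := by
      refine (L.isRelLowerSet_faces (f.map_faces _ x.support_mem)).2
        Finsupp.mapDomain_support ?_
      rw [Finset.nonempty_iff_ne_empty]
      intro h
      rw [Finsupp.sum, h, Finset.sum_empty] at hsum
      exact zero_ne_one hsum
    nonneg := by
      intro w
      rw [Finsupp.mapDomain, Finsupp.sum_apply, Finsupp.sum]
      refine Finset.sum_nonneg fun v _ => ?_
      rw [Finsupp.single_apply]
      split_ifs
      · exact x.nonneg v
      · exact le_rfl
    sum_eq_one := hsum }

/-- A simplicial map is non-degenerate if it is injective on every simplex. -/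
def NonDegenerate (f : SimplicialMap K L) : Prop :=
  ∀ σ ∈ K.faces, Set.InjOn f (σ : Set V)

end SimplicialMap

/-- The complex has dimension exactly three. -/
def IsThreeDimensional {V : Type*} (K : AbstractSimplicialComplex V) : Prop :=
  (∀ σ ∈ K.faces, σ.card ≤ 4) ∧ ∃ σ ∈ K.faces, σ.card = 4

/-! ### The equivalence relations `Φ` and `Ψ` -/

/-- The points near which a map fails to be injective. -/
def Sing {A B : Type*} [TopologicalSpace A] (g : A → B) : Set A :=
  {x | ∀ U ∈ nhds x, ¬ Set.InjOn g U}

namespace SimplicialMap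

variable {V W : Type*} {K : AbstractSimplicialComplex V} {L : AbstractSimplicialComplex W}

/-- `Φ(f)`: having the same image. -/
def Phi (f : SimplicialMap K L) : Setoid (Realization K) := Setoid.ker f.real

/-- For `R ⊆ Φ(f)`, the induced map from the quotient space. -/
def descend (f : SimplicialMap K L) (R : Setoid (Realization K)) (h : R ≤ f.Phi) :
    Quotient R → Realization L :=
  Quotient.lift f.real fun _ _ hxy => h hxy

open Classical in
/-- Admissible relations: if two simplices of the same dimension have the same image, and
two interior points of them with the same image are equivalent, then the relation identifies
the two (closed) simplices, compatibly with `f`. -/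
def Admissible (f : SimplicialMap K L) (R : Setoid (Realization K)) : Prop :=
  ∀ σ₁ ∈ K.faces, ∀ σ₂ ∈ K.faces, σ₁.card = σ₂.card → σ₁.image f = σ₂.image f →
    (∃ x₁ x₂ : Realization K, x₁.carrier = σ₁ ∧ x₂.carrier = σ₂ ∧
      f.real x₁ = f.real x₂ ∧ R x₁ x₂) →
    ∀ y₁ y₂ : Realization K, y₁.carrier ⊆ σ₁ → y₂.carrier ⊆ σ₂ →
      f.real y₁ = f.real y₂ → R y₁ y₂

/-- `Ψ(f)`: the smallest admissible equivalence relation inside `Φ(f)` which kills all the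
singularities, that is, for which the induced map from the quotient space is immersive. -/
def Psi (f : SimplicialMap K L) : Setoid (Realization K) :=
  sInf {R | f.Admissible R ∧ ∃ h : R ≤ f.Phi, Sing (f.descend R h) = ∅}

end SimplicialMap

/-! ### Geometric simple connectivity -/

open Classical in
/-- The graph on the vertices of `K` whose edges are the given 1-simplices. -/
def edgeGraph {V : Type*} (K : PreAbstractSimplicialComplex V) (E : Set (Finset V)) :
    SimpleGraph {v : V // {v} ∈ K.faces} where
  Adj u v := u ≠ v ∧ ({u.1, v.1} : Finset V) ∈ E
  symm := ⟨fun u v h => ⟨h.1.symm, by rw [Finset.pair_comm]; exact h.2⟩⟩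
  loopless := ⟨fun u h => h.1 rfl⟩

open Classical in
/-- How many times the boundary of the 2-simplex `D` goes through the 1-simplex `e`. -/
def intersectionNumber {V : Type*} (D e : Finset V) : ℕ := if e ⊆ D then 1 else 0

/-- A decomposition `K = T ∪ ∑ H¹ᵢ ∪ ∑ H²ⱼ ∪ (other cells of dimension ≥ 2)` where `T` is a tree
(a subcomplex, hence closed in the weak topology and properly embedded), the 1-cells `H¹ᵢ` and the
2-cells `H²ⱼ` are indexed by the same set of natural numbers, and the geometric intersection
matrix is of the form "easy id + nilpotent". -/
structure GSCDecomposition {V : Type*} (K : PreAbstractSimplicialComplex V) where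
  /-- the 1-simplices of the tree `T`; all vertices belong to `T` -/
  tree : Set (Finset V)
  idx : Set ℕ
  H1 : ℕ → Finset V
  H2 : ℕ → Finset V
  tree_mem : ∀ e ∈ tree, e ∈ K.faces ∧ e.card = 2
  isTree : (edgeGraph K tree).IsTree
  H1_mem : ∀ i ∈ idx, H1 i ∈ K.faces ∧ (H1 i).card = 2 ∧ H1 i ∉ tree
  H1_injOn : Set.InjOn H1 idx
  H1_exhaust : ∀ e ∈ K.faces, e.card = 2 → e ∉ tree → ∃ i ∈ idx, H1 i = e
  H2_mem : ∀ j ∈ idx, H2 j ∈ K.faces ∧ (H2 j).card = 3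
  H2_injOn : Set.InjOn H2 idx
  matrix : ∀ j ∈ idx, ∀ i ∈ idx, ∃ a : ℕ,
    intersectionNumber (H2 j) (H1 i) = (if j = i then 1 else 0) + a ∧ (0 < a → i < j)

/-- Geometric simple connectivity. -/
def IsGSC {V : Type*} (K : PreAbstractSimplicialComplex V) : Prop :=
  Nonempty (GSCDecomposition K)

/-- The decomposition of `K` restricts to one of the subcomplex `L`: the part of the tree in `L`
is a tree containing all vertices of `L`, and the 2-cells paired with 1-cells of `L` are in `L`. -/
def GSCDecomposition.RestrictsTo {V : Type*} {K : PreAbstractSimplicialComplex V}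
    (D : GSCDecomposition K) (L : PreAbstractSimplicialComplex V) : Prop :=
  (edgeGraph L {e | e ∈ D.tree ∧ e ∈ L.faces}).IsTree ∧
    ∀ i ∈ D.idx, D.H1 i ∈ L.faces → D.H2 i ∈ L.faces

/-! ### Representations -/

/-- Three-dimensional (inverse) representations `f : X → N`. -/
structure IsRepresentation {A B : Type*} {X : AbstractSimplicialComplex A}
    {N : AbstractSimplicialComplex B} (f : SimplicialMap X N) : Prop where
  countable : Countable A
  dim : IsThreeDimensional X
  gsc : IsGSC X.toPreAbstractSimplicialComplex
  nonDegenerate : f.NonDegenerate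
  psi_eq_phi : f.Psi = f.Phi
  essentiallySurjective : closure (Set.range f.real) = Set.univ

/-! ### Good presentations -/

/-- A finite 3-dimensional complex `M` together with its decomposition into gsc pieces `Δᵢ`,
glued along the gsc faces `g_a`, where `g_a` is common to the pieces `src a` and `tgt a`. -/
structure GoodPresentation (V I A : Type*) where
  M : AbstractSimplicialComplex V
  piece : I → PreAbstractSimplicialComplex V
  face : A → PreAbstractSimplicialComplex V
  src : A → I
  tgt : A → I
  src_ne_tgt : ∀ a, src a ≠ tgt a
  dim : IsThreeDimensional M
  /-- `M` is the union of the pieces -/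
  mem_iff : ∀ σ, σ ∈ M.faces ↔ ∃ i, σ ∈ (piece i).faces
  face_le_src : ∀ a, face a ≤ piece (src a)
  face_le_tgt : ∀ a, face a ≤ piece (tgt a)
  /-- faces are full subcomplexes of the two adjacent pieces -/
  full_src : ∀ a, ∀ σ ∈ (piece (src a)).faces, (∀ v ∈ σ, {v} ∈ (face a).faces) →
    σ ∈ (face a).faces
  full_tgt : ∀ a, ∀ σ ∈ (piece (tgt a)).faces, (∀ v ∈ σ, {v} ∈ (face a).faces) →
    σ ∈ (face a).faces
  /-- `M` arises from the disjoint union of the pieces by gluing along the faces only: if a simplex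
  lies in two pieces, these are joined by a chain of faces that contain it -/
  glue : ∀ σ ∈ M.faces, ∀ i j, σ ∈ (piece i).faces → σ ∈ (piece j).faces →
    Relation.EqvGen (fun k l => ∃ a, src a = k ∧ tgt a = l ∧ σ ∈ (face a).faces) i j
  /-- the pieces are gsc -/
  gsc_piece : ∀ i, IsGSC (piece i)
  /-- the faces are gsc subcomplexes of the adjacent pieces -/
  gsc_src : ∀ a, ∃ D : GSCDecomposition (piece (src a)), D.RestrictsTo (face a)
  gsc_tgt : ∀ a, ∃ D : GSCDecomposition (piece (tgt a)), D.RestrictsTo (face a)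

namespace GoodPresentation

variable {V I A : Type*} (P : GoodPresentation V I A)

/-- The pieces are joined in the pattern of a tree by the faces in `T` (one edge for each face),
and every piece is used. -/
def IsArborescent (T : Set A) : Prop :=
  (SimpleGraph.fromRel fun i j => ∃ a ∈ T, P.src a = i ∧ P.tgt a = j).IsTree ∧
    Set.InjOn (fun a => s(P.src a, P.tgt a)) T

/-- The vertices of the disjoint union of the pieces. -/
structure PieceVertex where
  idx : I
  point : V
  mem : {point} ∈ (P.piece idx).faces

/-- Gluing of two pieces along a face in `T`. -/
def DomainRel (T : Set A) (v w : P.PieceVertex) : Prop :=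
  ∃ a ∈ T, P.src a = v.idx ∧ P.tgt a = w.idx ∧ v.point = w.point ∧ {v.point} ∈ (P.face a).faces

/-- The vertices of the fundamental domain. -/
abbrev DomainVertex (T : Set A) : Type _ := Quot (P.DomainRel T)

open Classical in
/-- The fundamental domain `Δ`: the arborescent union of all the pieces `Δᵢ`, along the
faces in `T`. -/
def domain (T : Set A) : AbstractSimplicialComplex (P.DomainVertex T) where
  faces := {σ | ∃ i, ∃ τ : Finset P.PieceVertex, (∀ v ∈ τ, v.idx = i) ∧
    τ.image PieceVertex.point ∈ (P.piece i).faces ∧ σ = τ.image (Quot.mk _)}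
  isRelLowerSet_faces := by
    rintro σ ⟨i, τ, hi, hτ, rfl⟩
    refine ⟨?_, ?_⟩
    · have h := ((P.piece i).isRelLowerSet_faces hτ).1
      rw [Finset.image_nonempty] at h ⊢
      exact h
    · intro ρ hρ hne
      obtain ⟨τ', hτ', rfl⟩ := Finset.subset_image_iff.mp hρ
      refine ⟨i, τ', fun v hv => hi v (hτ' hv), ?_, rfl⟩
      exact ((P.piece i).isRelLowerSet_faces hτ).2 (Finset.image_subset_image hτ')
        (Finset.image_nonempty.mpr (Finset.image_nonempty.mp hne))
  singleton_mem := by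
    intro d
    induction d using Quot.ind with
    | mk v => exact ⟨v.idx, {v}, by simp, by simpa using v.mem, by simp⟩

open Classical in
/-- The natural map `Δ → M`. -/
def proj (T : Set A) : SimplicialMap (P.domain T) P.M where
  toFun := Quot.lift PieceVertex.point fun _ _ ⟨_, _, _, _, h, _⟩ => h
  map_faces := by
    rintro _ ⟨i, τ, _, hτ, rfl⟩
    rw [Finset.image_image]
    exact (P.mem_iff _).2 ⟨i, hτ⟩

/-- The set `Σ` of the faces not used for constructing `Δ`. Every such face `g_a` gives two free
faces of `Δ`, namely `(a, true)` in the piece `src a` and `(a, false)` in the piece `tgt a`. -/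
abbrev OuterFace (_ : GoodPresentation V I A) (T : Set A) : Type _ := {a : A // a ∉ T} × Bool

variable {P} in
/-- The fixed point free involution `j` of `Σ`. -/
def OuterFace.j {T : Set A} (g : P.OuterFace T) : P.OuterFace T := (g.1, !g.2)

variable {P} in
/-- The piece that contains a free face. -/
def OuterFace.side {T : Set A} (g : P.OuterFace T) : I := if g.2 then P.src g.1 else P.tgt g.1

/-- The group `Ḡ`: the free monoid on `Σ` modulo the relations `g · j g = j g · g = 1`
(this is how Mathlib defines a free group, as lists in `α × Bool` modulo cancellation). -/
abbrev FreeCover (_ : GoodPresentation V I A) (T : Set A) : Type _ := FreeGroup {a : A // a ∉ T}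

variable {P} in
/-- The generator of `Ḡ` given by an element of `Σ`. -/
def OuterFace.letter {T : Set A} (g : P.OuterFace T) : P.FreeCover T := FreeGroup.mk [g]

/-- The gluing of the copies of `Δ` indexed by `Ḡ`: for `x` in `Ḡ` and `g` in `Σ`, the face `g` of
`x Δ` is glued to the face `j g` of `x g Δ`. -/
def CoverRel (T : Set A) (p q : P.FreeCover T × P.DomainVertex T) : Prop :=
  ∃ g : P.OuterFace T, ∃ v w : P.PieceVertex, v.idx = g.side ∧ w.idx = g.j.side ∧
    v.point = w.point ∧ {v.point} ∈ (P.face g.1).faces ∧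
    p.2 = Quot.mk _ v ∧ q.2 = Quot.mk _ w ∧ q.1 = p.1 * g.letter

/-- The vertices of `X`. -/
abbrev CoverVertex (T : Set A) : Type _ := Quot (P.CoverRel T)

/-- The vertex `d` of the copy `x Δ`. -/
def coverMk (T : Set A) (x : P.FreeCover T) (d : P.DomainVertex T) : P.CoverVertex T :=
  Quot.mk _ (x, d)

open Classical in
/-- The complex `X`: the quotient of the arborescent union of the fundamental domains `x Δ`,
for `x` in `Ḡ`. -/
def cover (T : Set A) : AbstractSimplicialComplex (P.CoverVertex T) where
  faces := {σ | ∃ x, ∃ τ ∈ (P.domain T).faces, σ = τ.image (P.coverMk T x)}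
  isRelLowerSet_faces := by
    rintro σ ⟨x, τ, hτ, rfl⟩
    refine ⟨Finset.image_nonempty.mpr ((P.domain T).isRelLowerSet_faces hτ).1, ?_⟩
    intro ρ hρ hne
    obtain ⟨τ', hτ', rfl⟩ := Finset.subset_image_iff.mp hρ
    exact ⟨x, τ', ((P.domain T).isRelLowerSet_faces hτ).2 hτ' (Finset.image_nonempty.mp hne), rfl⟩
  singleton_mem := by
    intro d
    induction d using Quot.ind with
    | mk p => exact ⟨p.1, {p.2}, (P.domain T).singleton_mem _, by simp [coverMk]⟩

/-- The inclusion of the copy `x Δ` into `X`. -/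
def copy (T : Set A) (x : P.FreeCover T) : SimplicialMap (P.domain T) (P.cover T) where
  toFun := P.coverMk T x
  map_faces := fun σ hσ => ⟨x, σ, hσ, rfl⟩

open Classical in
/-- The tautological map `F : X → M`. -/
def taut (T : Set A) : SimplicialMap (P.cover T) P.M where
  toFun := Quot.lift (fun p => P.proj T p.2) (by
    rintro p q ⟨_, v, w, _, _, h, _, hp, hq, _⟩
    simp only [hp, hq]
    exact h)
  map_faces := by
    rintro _ ⟨x, τ, hτ, rfl⟩
    rw [Finset.image_image]
    exact (P.proj T).map_faces τ hτ

/-- The natural left action of `Ḡ` on `X`: the element `y` sends `x Δ` to `y x Δ`. -/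
instance coverAction (T : Set A) : MulAction (P.FreeCover T) (P.CoverVertex T) where
  smul y := Quot.map (fun p => (y * p.1, p.2)) (by
    rintro p q ⟨g, v, w, h1, h2, h3, h4, h5, h6, h7⟩
    exact ⟨g, v, w, h1, h2, h3, h4, h5, h6, by simp only [h7, mul_assoc]⟩)
  one_smul := by
    intro b
    induction b using Quot.ind with
    | mk p => exact congrArg (Quot.mk _) (Prod.ext (one_mul _) rfl)
  mul_smul := by
    intro y z b
    induction b using Quot.ind with
    | mk p => exact congrArg (Quot.mk _) (Prod.ext (mul_assoc _ _ _) rfl)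

end GoodPresentation

/-! ### Fundamental groups, universal coverings and deck transformations -/

/-- The fundamental group with the concatenation of loops as product. (The product of Mathlib's
`FundamentalGroup` is concatenation in the reverse order.) -/
abbrev PiOne (S : Type*) [TopologicalSpace S] (x : S) : Type _ := (FundamentalGroup S x)ᵐᵒᵖ

/-- The class of a loop. -/
def loopClass {S : Type*} [TopologicalSpace S] {x : S} (γ : Path x x) : PiOne S x :=
  MulOpposite.op (FundamentalGroup.fromPath (Path.Homotopic.Quotient.mk γ))

/-- The loop `γ` lifts along `φ` to a path from `x` to `y`. -/
def LiftsTo {S E : Type*} [TopologicalSpace S] [TopologicalSpace E] (φ : E → S) {b : S}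
    (γ : Path b b) (x y : E) : Prop :=
  ∃ δ : Path x y, ∀ t, φ (δ t) = γ t

/-- The simplicial map `p : N → M` is a universal covering. -/
structure IsUniversalCovering {V W : Type*} {N : AbstractSimplicialComplex W}
    {M : AbstractSimplicialComplex V} (p : SimplicialMap N M) : Prop where
  covering : IsCoveringMap p.real
  simplyConnected : SimplyConnectedSpace (Realization N)

open Classical in
/-- The simplicial map given by an element of a group which permutes the vertices of `N` and maps
simplices to simplices. -/
def actionMap {G W : Type*} [Group G] [MulAction G W] {N : AbstractSimplicialComplex W}
    (h : ∀ g : G, ∀ σ ∈ N.faces, σ.image (fun w => g • w) ∈ N.faces) (g : G) :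
    SimplicialMap N N where
  toFun := fun w => g • w
  map_faces := h g

open Classical in
/-- The action of `G` on `N` is the natural action by deck transformations of `p : N → M`, where
`G` is identified with the fundamental group of `M` by `e`: it is simplicial, it preserves the
fibres of `p`, and the lift of a loop in the class `e g` which starts at the base point `y` of `N`
ends at `g y`. -/
structure IsNaturalAction {G V W : Type*} [Group G] [MulAction G W]
    {N : AbstractSimplicialComplex W} {M : AbstractSimplicialComplex V} (p : SimplicialMap N M)
    {b : Realization M} (e : G ≃* PiOne (Realization M) b) (y : Realization N) : Prop where
  simplicial : ∀ g : G, ∀ σ ∈ N.faces, σ.image (fun w => g • w) ∈ N.faces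
  deck : ∀ (g : G) (w : W), p (g • w) = p w
  monodromy : ∀ (g : G) (γ : Path b b), loopClass γ = e g →
    LiftsTo p.real γ y ((actionMap simplicial g).real y)

end

/-! Write `N` for the universal covering space. A simplicial covering is the same thing as a
non-degenerate simplicial map that lifts simplices uniquely at every vertex
(`isStarBijective_of_isCoveringMap`, `isCoveringMap_real`). Statements about lifts and deck
transformations can therefore be propagated across simplices from one vertex to all others
(`vertex_induction`).

The lift. The two lifts of a face given by `s` on its two sides differ by a deck transformation,
because the face is connected (`exists_smul_eq_of_face`). These deck transformations, for the faces
outside `T`, are the values of `χ` on the free generators, and `f(x d) = χ(x) s(d)` respects the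
gluings and is equivariant. If `δ` joins `b` to `y b` in `X`, then `f ∘ δ` lifts `F ∘ δ` and ends at
`χ(y) s(b)`; since `N` is simply connected, this identifies the class of `F ∘ δ` with `χ(y)`.
Surjectivity of `χ` follows from that of `f` on vertices and from the freeness of the deck action.

`Ψ = Φ`. Each simplex of `N` at `f v` is the image of a simplex at `v`: its projection lies in some
piece, and a chain of faces containing the vertex leads to a copy of that piece
(`exists_lift_of_comp_eq_taut`). Now let `R` be a relation competing in the definition of `Ψ`. The
map from the quotient complex to `N` is onto on stars because `f` is, and injective on stars because
it has no singularities. It is thus a covering of a simply connected space with connected total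
space, hence injective, and `R = Φ` (`psi_eq_phi_of_exists_lift`).

Geometric simple connectivity. The copies of the pieces form a rooted tree, each glued to its parent
along a full subcomplex that meets its tree in a tree. The union of the trees, each edge being
judged in the first piece containing it, is a tree. Every other edge is paired with a triangle of
that first piece; the remaining edges of the triangle have smaller index there or belong to earlier
pieces (`PieceTree.isGSC`). -/

noncomputable section

/-! ### Weak topology, segments and simplicial maps. -/

section RealizationBasics

open Classical

variable {V W : Type*} {K : AbstractSimplicialComplex V} {L : AbstractSimplicialComplex W}

namespace Realization

theorem carrier_nonempty (x : Realization K) : x.carrier.Nonempty :=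
  (K.isRelLowerSet_faces x.support_mem).1

theorem mem_carrier {x : Realization K} {v : V} : v ∈ x.carrier ↔ 0 < x.weight v := by
  rw [carrier, Finsupp.mem_support_iff]
  exact ⟨fun h => lt_of_le_of_ne (x.nonneg v) h.symm, fun h => h.ne'⟩

theorem continuous_iff_forall_simplex {S : Type*} [TopologicalSpace S] {g : Realization K → S} :
    Continuous g ↔ ∀ σ ∈ K.faces,
      @Continuous {x : Realization K // x.carrier ⊆ σ} S
        (TopologicalSpace.induced (fun x (v : V) => x.1.weight v) inferInstance) _
        (fun x => g x.1) := by
  rw [continuous_iSup_dom]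
  simp only [continuous_coinduced_dom, Subtype.forall]
  rfl

theorem isOpen_iff_forall_simplex {U : Set (Realization K)} :
    IsOpen U ↔ ∀ σ ∈ K.faces,
      @IsOpen {x : Realization K // x.carrier ⊆ σ}
        (TopologicalSpace.induced (fun x (v : V) => x.1.weight v) inferInstance)
        (Subtype.val ⁻¹' U) := by
  rw [isOpen_iSup_iff]
  simp only [isOpen_coinduced, Subtype.forall]

/-- Barycentric coordinates do not detect continuity for the weak topology in general, but within
one closed simplex they do. -/
theorem continuous_of_carrier_subset {S : Type*} [TopologicalSpace S] {g : S → Realization K}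
    {σ : Finset V} (hσ : σ ∈ K.faces) (hg : ∀ s, (g s).carrier ⊆ σ)
    (hc : ∀ v, Continuous fun s => (g s).weight v) : Continuous g := by
  let t : TopologicalSpace {x : Realization K // x.carrier ⊆ σ} :=
    TopologicalSpace.induced (fun x (v : V) => x.1.weight v) inferInstance
  have h1 : Continuous (Subtype.val : {x : Realization K // x.carrier ⊆ σ} → Realization K) :=
    continuous_iff_forall_simplex.1 continuous_id σ hσ
  have h2 : Continuous (fun s => (⟨g s, hg s⟩ : {x : Realization K // x.carrier ⊆ σ})) :=
    continuous_induced_rng.2 (continuous_pi hc)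
  exact h1.comp h2

theorem continuous_weight (v : V) : Continuous fun x : Realization K => x.weight v := by
  rw [continuous_iff_forall_simplex]
  intro σ _
  let t : TopologicalSpace {x : Realization K // x.carrier ⊆ σ} :=
    TopologicalSpace.induced (fun x (v : V) => x.1.weight v) inferInstance
  exact (continuous_apply v).comp (continuous_induced_dom
    (f := fun (x : {x : Realization K // x.carrier ⊆ σ}) (v : V) => x.1.weight v))

/-- The open star of a vertex. -/
def openStar (K : AbstractSimplicialComplex V) (v : V) : Set (Realization K) := {x | v ∈ x.carrier}

theorem isOpen_openStar (v : V) : IsOpen (openStar K v) := by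
  have : openStar K v = {x | 0 < x.weight v} := by ext x; exact mem_carrier
  rw [this]
  exact isOpen_lt continuous_const (continuous_weight v)

/-- The point of the realization given by a vertex. -/
def vert (K : AbstractSimplicialComplex V) (v : V) : Realization K where
  weight := Finsupp.single v 1
  support_mem := by
    rw [Finsupp.support_single v one_ne_zero]; exact K.singleton_mem v
  nonneg := by
    intro w
    rw [Finsupp.single_apply]
    split_ifs <;> norm_num
  sum_eq_one := by simp

@[simp] theorem carrier_vert (v : V) : (vert K v).carrier = {v} :=
  Finsupp.support_single v one_ne_zero

theorem vert_injective : Function.Injective (vert K) := by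
  intro v w h
  have := congrArg carrier h
  simpa using this

theorem exists_carrier_eq {σ : Finset V} (hσ : σ ∈ K.faces) :
    ∃ x : Realization K, x.carrier = σ := by
  have hne := (K.isRelLowerSet_faces hσ).1
  have hc : (0 : ℝ) < σ.card := by exact_mod_cast hne.card_pos
  -- The witness is the barycentre of `σ`.
  have hs : (Finsupp.indicator σ (fun _ _ => (σ.card : ℝ)⁻¹)).support = σ := by
    ext v
    simp [Finsupp.indicator_apply, hc.ne']
  refine ⟨⟨Finsupp.indicator σ (fun _ _ => (σ.card : ℝ)⁻¹), by rwa [hs], ?_, ?_⟩, hs⟩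
  · intro v
    rw [Finsupp.indicator_apply]
    split_ifs <;> positivity
  · rw [Finsupp.sum, hs, Finset.sum_congr rfl (g := fun _ => (σ.card : ℝ)⁻¹)]
    · simp [hc.ne']
    · intro v hv
      simp [Finsupp.indicator_apply, hv]

theorem exists_segment {σ : Finset V} (hσ : σ ∈ K.faces) {x y : Realization K}
    (hx : x.carrier ⊆ σ) (hy : y.carrier ⊆ σ) :
    ∃ γ : Path x y, ∀ t : unitInterval, (γ t).weight = (1 - (t : ℝ)) • x.weight + (t : ℝ) • y.weight := by
  have key : ∀ t : unitInterval, ∃ z : Realization K,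
      z.weight = (1 - (t : ℝ)) • x.weight + (t : ℝ) • y.weight := by
    intro t
    have hsum : (((1 - (t : ℝ)) • x.weight + (t : ℝ) • y.weight).sum fun _ t => t) = 1 := by
      rw [Finsupp.sum_add_index' (fun _ => rfl) (fun _ _ _ => rfl),
        Finsupp.sum_smul_index' (fun _ => rfl), Finsupp.sum_smul_index' (fun _ => rfl)]
      have h1 := x.sum_eq_one
      have h2 := y.sum_eq_one
      simp only [Finsupp.sum, smul_eq_mul, ← Finset.mul_sum] at h1 h2 ⊢
      rw [h1, h2]; ring
    refine ⟨⟨_, ?_, ?_, hsum⟩, rfl⟩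
    · refine (K.isRelLowerSet_faces hσ).2 ?_ ?_
      · refine Finsupp.support_add.trans (Finset.union_subset ?_ ?_)
        · exact Finsupp.support_smul.trans hx
        · exact Finsupp.support_smul.trans hy
      · rw [Finset.nonempty_iff_ne_empty]
        intro h
        rw [Finsupp.sum, h, Finset.sum_empty] at hsum
        exact zero_ne_one hsum
    · intro v
      have h1 := mul_nonneg (sub_nonneg.2 t.2.2) (x.nonneg v)
      have h2 := mul_nonneg t.2.1 (y.nonneg v)
      simpa using add_nonneg h1 h2
  choose γ hγ using key
  refine ⟨⟨⟨γ, continuous_of_carrier_subset hσ ?_ ?_⟩, ?_, ?_⟩, hγ⟩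
  · intro t
    rw [carrier, hγ]
    refine Finsupp.support_add.trans (Finset.union_subset ?_ ?_)
    · exact Finsupp.support_smul.trans hx
    · exact Finsupp.support_smul.trans hy
  · intro v
    simp only [hγ, Finsupp.add_apply, Finsupp.smul_apply, smul_eq_mul]
    fun_prop
  · ext1
    simp [hγ]
  · ext1
    simp [hγ]

/-- The vertices of `y` get positive weight as soon as `t > 0`, and `x` adds no others. This
produces interior points of a simplex arbitrarily close to a vertex, which is what turns local
hypotheses at the vertex into statements about simplices. -/
theorem carrier_of_segment {x y z : Realization K} {t : unitInterval} (ht : 0 < t)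
    (hz : z.weight = (1 - (t : ℝ)) • x.weight + (t : ℝ) • y.weight)
    (hxy : x.carrier ⊆ y.carrier) : z.carrier = y.carrier := by
  have ht' : (0 : ℝ) < t := ht
  ext v
  have h1 := mul_nonneg (sub_nonneg.2 t.2.2) (x.nonneg v)
  rw [mem_carrier, hz, mem_carrier]
  simp only [Finsupp.add_apply, Finsupp.smul_apply, smul_eq_mul]
  constructor
  · intro h
    by_contra hv
    have hyv : y.weight v = 0 := le_antisymm (not_lt.1 hv) (y.nonneg v)
    have hxv : ¬ 0 < x.weight v := fun h => hv (mem_carrier.1 (hxy (mem_carrier.2 h)))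
    have hxv : x.weight v = 0 := le_antisymm (not_lt.1 hxv) (x.nonneg v)
    simp [hyv, hxv] at h
  · intro h
    have := mul_pos ht' h
    linarith

/-- A set of vertices of a connected complex that is closed under passing to the other vertices
of a simplex is empty or everything. -/
theorem vertex_induction [PreconnectedSpace (Realization K)] {C : Set V} {v₀ : V} (h₀ : v₀ ∈ C)
    (hC : ∀ σ ∈ K.faces, ∀ v ∈ σ, ∀ w ∈ σ, v ∈ C → w ∈ C) (v : V) : v ∈ C := by
  have h1 : IsOpen (⋃ v ∈ C, openStar K v) := isOpen_biUnion fun v _ => isOpen_openStar v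
  have h2 : (⋃ v ∈ C, openStar K v)ᶜ = ⋃ v ∈ Cᶜ, openStar K v := by
    ext x
    simp only [Set.mem_compl_iff, Set.mem_iUnion, openStar, Set.mem_ofPred_eq, exists_prop, not_exists,
      not_and]
    constructor
    · intro h
      obtain ⟨w, hw⟩ := x.carrier_nonempty
      exact ⟨w, fun hwC => h w hwC hw, hw⟩
    · rintro ⟨w, hw, hwx⟩ u hu hux
      exact hw (hC _ x.support_mem u hux w hwx hu)
  have h3 : IsClopen (⋃ v ∈ C, openStar K v) := by
    refine ⟨⟨?_⟩, h1⟩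
    rw [h2]
    exact isOpen_biUnion fun v _ => isOpen_openStar v
  have h4 := h3.eq_univ ⟨vert K v₀, by simp only [Set.mem_iUnion]; exact ⟨v₀, h₀, by simp [openStar]⟩⟩
  have h5 : vert K v ∈ ⋃ v ∈ C, openStar K v := h4 ▸ Set.mem_univ _
  simp only [Set.mem_iUnion, openStar, Set.mem_ofPred_eq, carrier_vert, Finset.mem_singleton] at h5
  obtain ⟨w, hw, rfl⟩ := h5
  exact hw

theorem joined_of_carrier_subset {σ : Finset V} (hσ : σ ∈ K.faces) {x y : Realization K}
    (hx : x.carrier ⊆ σ) (hy : y.carrier ⊆ σ) : Joined x y :=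
  ⟨(exists_segment hσ hx hy).choose⟩

theorem pathConnectedSpace_of_joined (v₀ : V)
    (h : ∀ v, Joined (vert K v₀) (vert K v)) : PathConnectedSpace (Realization K) := by
  have h' : ∀ x : Realization K, Joined (vert K v₀) x := by
    intro x
    obtain ⟨v, hv⟩ := x.carrier_nonempty
    exact (h v).trans (joined_of_carrier_subset x.support_mem
      (by rw [carrier_vert]; exact Finset.singleton_subset_iff.2 hv) subset_rfl)
  exact ⟨⟨vert K v₀⟩, fun x y => (h' x).symm.trans (h' y)⟩

end Realization

namespace SimplicialMap

open Realization

theorem carrier_real_subset (f : SimplicialMap K L) (x : Realization K) :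
    (f.real x).carrier ⊆ x.carrier.image f := Finsupp.mapDomain_support

theorem carrier_real (f : SimplicialMap K L) (x : Realization K) :
    (f.real x).carrier = x.carrier.image f := by
  refine (f.carrier_real_subset x).antisymm ?_
  intro w hw
  obtain ⟨v, hv, rfl⟩ := Finset.mem_image.1 hw
  rw [mem_carrier] at hv ⊢
  change 0 < (x.weight.mapDomain f) (f v)
  rw [Finsupp.mapDomain, Finsupp.sum_apply, Finsupp.sum]
  refine Finset.sum_pos' (fun u _ => ?_) ⟨v, mem_carrier.2 hv, by simpa using hv⟩
  rw [Finsupp.single_apply]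
  split_ifs
  · exact x.nonneg u
  · exact le_rfl

theorem real_weight_apply (f : SimplicialMap K L) {σ : Finset V} (hf : Set.InjOn f (σ : Set V))
    {x : Realization K} (hx : x.carrier ⊆ σ) {v : V} (hv : v ∈ σ) :
    (f.real x).weight (f v) = x.weight v :=
  Finsupp.mapDomain_apply' (σ : Set V) x.weight (by exact_mod_cast hx) hf hv

theorem real_injOn (f : SimplicialMap K L) {σ : Finset V} (hf : Set.InjOn f (σ : Set V))
    {x y : Realization K} (hx : x.carrier ⊆ σ) (hy : y.carrier ⊆ σ) (h : f.real x = f.real y) :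
    x = y := by
  ext v
  by_cases hv : v ∈ σ
  · rw [← f.real_weight_apply hf hx hv, ← f.real_weight_apply hf hy hv, h]
  · rw [Finsupp.notMem_support_iff.1 (fun h' => hv (hx h')),
      Finsupp.notMem_support_iff.1 (fun h' => hv (hy h'))]

/-- The weights are pushed along a right inverse of `f` on `σ`, so injectivity on `σ` is not needed.
-/
theorem exists_real_eq (f : SimplicialMap K L) {σ : Finset V} (hσ : σ ∈ K.faces)
    {y : Realization L} (hy : y.carrier ⊆ σ.image f) :
    ∃ x : Realization K, x.carrier ⊆ σ ∧ f.real x = y := by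
  have hne := (K.isRelLowerSet_faces hσ).1
  have : Nonempty V := ⟨hne.choose⟩
  have hinv : ∀ w ∈ y.carrier, Function.invFunOn f (σ : Set V) w ∈ σ ∧
      f (Function.invFunOn f (σ : Set V) w) = w := by
    intro w hw
    have : ∃ a ∈ (σ : Set V), f a = w := by
      obtain ⟨v, hv, rfl⟩ := Finset.mem_image.1 (hy hw); exact ⟨v, hv, rfl⟩
    exact ⟨Function.invFunOn_mem this, Function.invFunOn_eq this⟩
  have hsum : ((y.weight.mapDomain (Function.invFunOn f (σ : Set V))).sum fun _ t => t) = 1 := by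
    rw [Finsupp.sum_mapDomain_index (fun _ => rfl) (fun _ _ _ => rfl)]
    exact y.sum_eq_one
  have hsub : (y.weight.mapDomain (Function.invFunOn f (σ : Set V))).support ⊆ σ := by
    refine Finsupp.mapDomain_support.trans ?_
    intro v hv
    obtain ⟨w, hw, rfl⟩ := Finset.mem_image.1 hv
    exact (hinv w hw).1
  refine ⟨⟨y.weight.mapDomain (Function.invFunOn f (σ : Set V)), ?_, ?_, hsum⟩, hsub, ?_⟩
  · refine (K.isRelLowerSet_faces hσ).2 hsub ?_
    rw [Finset.nonempty_iff_ne_empty]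
    intro h
    rw [Finsupp.sum, h, Finset.sum_empty] at hsum
    exact zero_ne_one hsum
  · intro w
    rw [Finsupp.mapDomain, Finsupp.sum_apply, Finsupp.sum]
    refine Finset.sum_nonneg fun v _ => ?_
    rw [Finsupp.single_apply]
    split_ifs
    · exact y.nonneg v
    · exact le_rfl
  · ext1
    change Finsupp.mapDomain f (Finsupp.mapDomain _ y.weight) = y.weight
    rw [← Finsupp.mapDomain_comp]
    conv_rhs => rw [← Finsupp.mapDomain_id (v := y.weight)]
    exact Finsupp.mapDomain_congr fun w hw => (hinv w hw).2

theorem real_vert (f : SimplicialMap K L) (v : V) : f.real (vert K v) = vert L (f v) := by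
  ext1
  exact Finsupp.mapDomain_single

theorem real_segment (f : SimplicialMap K L) {x y z : Realization K} {t : unitInterval}
    (hz : z.weight = (1 - (t : ℝ)) • x.weight + (t : ℝ) • y.weight) :
    (f.real z).weight = (1 - (t : ℝ)) • (f.real x).weight + (t : ℝ) • (f.real y).weight := by
  change Finsupp.mapDomain f z.weight = _ • Finsupp.mapDomain f _ + _ • Finsupp.mapDomain f _
  rw [hz, Finsupp.mapDomain_add, Finsupp.mapDomain_smul, Finsupp.mapDomain_smul]

theorem continuous_real (f : SimplicialMap K L) : Continuous f.real := by
  rw [continuous_iff_forall_simplex]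
  intro σ hσ
  let t : TopologicalSpace {x : Realization K // x.carrier ⊆ σ} :=
    TopologicalSpace.induced (fun x (v : V) => x.1.weight v) inferInstance
  refine continuous_of_carrier_subset (f.map_faces σ hσ) (fun x =>
    (f.carrier_real_subset x.1).trans (Finset.image_subset_image x.2)) ?_
  intro w
  have h : ∀ x : {x : Realization K // x.carrier ⊆ σ}, (f.real x.1).weight w =
      ∑ v ∈ σ, if f v = w then x.1.weight v else 0 := by
    intro x
    change (x.1.weight.mapDomain f) w = _
    rw [Finsupp.mapDomain, Finsupp.sum_apply, Finsupp.sum]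
    simp only [Finsupp.single_apply]
    refine Finset.sum_subset x.2 fun v _ hv => ?_
    rw [Finsupp.notMem_support_iff.1 hv, ite_self]
  simp only [h]
  refine continuous_finsetSum _ fun v _ => ?_
  split_ifs
  · exact (continuous_apply v).comp (continuous_induced_dom
      (f := fun (x : {x : Realization K // x.carrier ⊆ σ}) (v : V) => x.1.weight v))
  · exact continuous_const

theorem real_eq_of_comp {U : Type*} {J : AbstractSimplicialComplex U} (f : SimplicialMap K L)
    (g : SimplicialMap L J) (h : SimplicialMap K J) (hc : ∀ v, g (f v) = h v)
    (x : Realization K) : g.real (f.real x) = h.real x := by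
  ext1
  change Finsupp.mapDomain g (Finsupp.mapDomain f x.weight) = Finsupp.mapDomain h x.weight
  rw [← Finsupp.mapDomain_comp]
  exact Finsupp.mapDomain_congr fun v _ => hc v

end SimplicialMap

end RealizationBasics

/-! ### Topological and combinatorial coverings. -/

section StarBijective

open Classical Realization

theorem IsCoveringMap.path_target_eq {E X : Type*} [TopologicalSpace E] [TopologicalSpace X]
    {p : E → X} (cov : IsCoveringMap p) {x x' y y' : E} (γ : Path x y) (γ' : Path x' y')
    (hx : x = x') (h : ∀ t, p (γ t) = p (γ' t)) : y = y' := by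
  have := cov.eq_of_comp_eq γ.continuous γ'.continuous (funext h) 0 (by simp [hx])
  simpa using congrFun this 1

/-- A path between two points of a fibre projects to a null-homotopic loop, so it is itself closed.
-/
theorem IsCoveringMap.injective_of_simplyConnected {E X : Type*} [TopologicalSpace E]
    [TopologicalSpace X] {p : E → X} (cov : IsCoveringMap p) [PathConnectedSpace E]
    [SimplyConnectedSpace X] : Function.Injective p := by
  intro x y hxy
  obtain ⟨γ⟩ := PathConnectedSpace.joined x y
  have hh := SimplyConnectedSpace.paths_homotopic
    ((γ.map cov.continuous).cast rfl hxy) (Path.refl (p x))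
  have h1 := cov.liftPath_apply_one_eq_of_homotopicRel hh x (by simp) (by simp)
  have h2 : (γ : C(unitInterval, E)) = cov.liftPath ((γ.map cov.continuous).cast rfl hxy) x
      (by simp) := by
    rw [cov.eq_liftPath_iff']
    exact ⟨rfl, by simp⟩
  have h3 : ContinuousMap.const unitInterval x = cov.liftPath (Path.refl (p x)) x (by simp) := by
    rw [cov.eq_liftPath_iff']
    exact ⟨rfl, rfl⟩
  have h4 := (DFunLike.congr_fun h2 1).trans (h1.trans (DFunLike.congr_fun h3 1).symm)
  simpa using h4.symm

variable {V W : Type*} {K : AbstractSimplicialComplex V} {L : AbstractSimplicialComplex W}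

namespace SimplicialMap

/-- Combinatorial coverings: non-degenerate maps that are bijective on the stars of vertices. -/
structure IsStarBijective (q : SimplicialMap K L) : Prop where
  nonDegenerate : q.NonDegenerate
  exists_lift : ∀ v, ∀ σ ∈ L.faces, q v ∈ σ → ∃ τ ∈ K.faces, v ∈ τ ∧ τ.image q = σ
  lift_unique : ∀ v, ∀ τ₁ ∈ K.faces, ∀ τ₂ ∈ K.faces, v ∈ τ₁ → v ∈ τ₂ →
    τ₁.image q = τ₂.image q → τ₁ = τ₂

/-- All three properties come from lifting segments of simplices, existence or uniqueness as the
case may be. -/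
theorem isStarBijective_of_isCoveringMap {p : SimplicialMap K L} (hp : IsCoveringMap p.real) :
    p.IsStarBijective := by
  have hnd : p.NonDegenerate := by
    intro σ hσ u hu w hw huw
    -- If two vertices of `σ` have the same image, the segment between them lifts a constant path.
    obtain ⟨γ, hγ⟩ := exists_segment (K := K) hσ (x := vert K u) (y := vert K w)
      (by simpa using hu) (by simpa using hw)
    refine vert_injective (K := K) (hp.path_target_eq (Path.refl _) γ rfl fun t => ?_)
    ext1
    rw [p.real_segment (hγ t), p.real_vert, p.real_vert, huw, ← add_smul]
    simp [p.real_vert, huw]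
  refine ⟨hnd, ?_, ?_⟩
  · intro v σ hσ hv
    obtain ⟨z, hz⟩ := exists_carrier_eq hσ
    -- A segment from `p v` to an interior point of `σ` is lifted from `v`. Just after time 0 the
    -- lift is still in the open star of `v`, and its carrier at that moment is the required
    -- simplex.
    obtain ⟨γ, hγ⟩ := exists_segment (K := L) hσ (x := vert L (p v)) (y := z)
      (by simpa using hv) hz.subset
    obtain ⟨δ, hδ, hδ0⟩ := hp.exists_path_lifts γ (vert K v) (by simp [p.real_vert])
    have h1 : IsOpen (δ ⁻¹' openStar K v) := (isOpen_openStar v).preimage δ.continuous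
    have h2 : (0 : unitInterval) ∈ δ ⁻¹' openStar K v := by
      rw [Set.mem_preimage, hδ0]; simp [openStar]
    have h3 : ∃ t : unitInterval, 0 < t ∧ δ t ∈ openStar K v := by
      have h4 : (nhdsWithin (0 : unitInterval) (Set.Ioi 0)).NeBot :=
        nhdsGT_neBot_of_exists_gt ⟨1, zero_lt_one⟩
      obtain ⟨t, ht1, ht2⟩ := h4.nonempty_of_mem
        (inter_mem_nhdsWithin (Set.Ioi 0) (h1.mem_nhds h2))
      exact ⟨t, ht1, ht2⟩
    obtain ⟨t, ht, hts⟩ := h3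
    refine ⟨(δ t).carrier, (δ t).support_mem, hts, ?_⟩
    rw [← p.carrier_real, show p.real (δ t) = γ t from congrFun hδ t,
      carrier_of_segment ht (hγ t) (by rw [hz]; simpa using hv), hz]
  · intro v τ₁ h₁ τ₂ h₂ hv₁ hv₂ h
    obtain ⟨z, hz⟩ := exists_carrier_eq (p.map_faces _ h₁)
    obtain ⟨z₁, hz₁, e₁⟩ := p.exists_real_eq h₁ hz.subset
    obtain ⟨z₂, hz₂, e₂⟩ := p.exists_real_eq h₂ (hz.trans h).subset
    -- The segments from `v` to the points over `z` in the two simplices have the same projection,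
    -- hence the same end.
    obtain ⟨γ₁, hγ₁⟩ := exists_segment (K := K) h₁ (x := vert K v) (by simpa using hv₁) hz₁
    obtain ⟨γ₂, hγ₂⟩ := exists_segment (K := K) h₂ (x := vert K v) (by simpa using hv₂) hz₂
    have hzz : z₁ = z₂ := hp.path_target_eq γ₁ γ₂ rfl fun t => by
      ext1
      rw [p.real_segment (hγ₁ t), p.real_segment (hγ₂ t), e₁, e₂]
    have key : ∀ τ ∈ K.faces, ∀ x : Realization K, x.carrier ⊆ τ →
        τ.image p ⊆ x.carrier.image p → x.carrier = τ := by
      intro τ hτ x hx hsub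
      refine hx.antisymm fun w hw => ?_
      obtain ⟨u, hu, huw⟩ := Finset.mem_image.1 (hsub (Finset.mem_image_of_mem _ hw))
      rwa [← hnd τ hτ (hx hu) hw huw]
    rw [← key τ₁ h₁ z₁ hz₁ (by rw [← p.carrier_real, e₁, hz]),
      ← key τ₂ h₂ z₂ hz₂ (by rw [← p.carrier_real, e₂, hz, h]), hzz]

namespace IsStarBijective

variable {q : SimplicialMap K L} (hq : q.IsStarBijective)
include hq

theorem exists_lift_of_subset {ρ : Finset V} (hρ : ρ ∈ K.faces) {σ : Finset W}
    (hσ : σ ∈ L.faces) (h : ρ.image q ⊆ σ) : ∃ τ ∈ K.faces, ρ ⊆ τ ∧ τ.image q = σ := by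
  obtain ⟨v, hv⟩ := (K.isRelLowerSet_faces hρ).1
  obtain ⟨τ, hτ, hvτ, rfl⟩ := hq.exists_lift v σ hσ (h (Finset.mem_image_of_mem _ hv))
  obtain ⟨ρ', hρ', e⟩ := Finset.subset_image_iff.1 h
  refine ⟨τ, hτ, ?_, rfl⟩
  have hv' : v ∈ ρ' := by
    obtain ⟨u, hu, huv⟩ := Finset.mem_image.1 (e.symm ▸ Finset.mem_image_of_mem q hv)
    rwa [← hq.nonDegenerate τ hτ (hρ' hu) hvτ huv]
  have hρK := (K.isRelLowerSet_faces hτ).2 hρ' ⟨v, hv'⟩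
  rw [← hq.lift_unique v ρ' hρK ρ hρ hv' hv e]
  exact hρ'

theorem eq_of_carrier {x y : Realization K} {v : V} (hx : v ∈ x.carrier) (hy : v ∈ y.carrier)
    (h : q.real x = q.real y) : x = y := by
  have hc : x.carrier = y.carrier := hq.lift_unique v _ x.support_mem _ y.support_mem hx hy
    ((q.carrier_real x).symm.trans ((congrArg carrier h).trans (q.carrier_real y)))
  exact q.real_injOn (hq.nonDegenerate _ y.support_mem) hc.subset subset_rfl h

/-- Each simplex `τ` lying over `σ` gives a continuous section over the closed simplex `σ`, and the
trace of `q(O)` on `σ` is the union of the preimages of `O` under these sections. -/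
theorem isOpenMap_real : IsOpenMap q.real := by
  intro O hO
  rw [isOpen_iff_forall_simplex]
  intro σ hσ
  let t : TopologicalSpace {x : Realization L // x.carrier ⊆ σ} :=
    TopologicalSpace.induced (fun x (v : W) => x.1.weight v) inferInstance
  have key : ∀ τ : {τ : Finset V // τ ∈ K.faces ∧ τ.image q = σ},
      ∃ g : {x : Realization L // x.carrier ⊆ σ} → Realization K,
        Continuous g ∧ ∀ x, (g x).carrier ⊆ τ.1 ∧ q.real (g x) = x.1 := by
    rintro ⟨τ, hτ, rfl⟩
    choose g hg using fun x : {x : Realization L // x.carrier ⊆ τ.image q} =>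
      q.exists_real_eq hτ x.2
    refine ⟨g, continuous_of_carrier_subset hτ (fun x => (hg x).1) fun v => ?_, hg⟩
    by_cases hv : v ∈ τ
    · have : ∀ x, (g x).weight v = x.1.weight (q v) := fun x => by
        rw [← q.real_weight_apply (hq.nonDegenerate τ hτ) (hg x).1 hv, (hg x).2]
      simp only [this]
      exact (continuous_apply (q v)).comp (continuous_induced_dom
        (f := fun (x : {x : Realization L // x.carrier ⊆ τ.image q}) (v : W) => x.1.weight v))
    · have : ∀ x, (g x).weight v = 0 := fun x =>
        Finsupp.notMem_support_iff.1 fun h => hv ((hg x).1 h)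
      simp only [this]
      exact continuous_const
  choose g hgc hg using key
  have : (Subtype.val ⁻¹' (q.real '' O) : Set {x : Realization L // x.carrier ⊆ σ}) =
      ⋃ τ, g τ ⁻¹' O := by
    ext x
    simp only [Set.mem_preimage, Set.mem_iUnion]
    constructor
    · rintro ⟨u, hu, hux⟩
      obtain ⟨τ, hτ, huτ, e⟩ := hq.exists_lift_of_subset u.support_mem hσ
        (by rw [← carrier, ← q.carrier_real, hux]; exact x.2)
      refine ⟨⟨τ, hτ, e⟩, ?_⟩
      rwa [q.real_injOn (hq.nonDegenerate τ hτ) (hg ⟨τ, hτ, e⟩ x).1 huτ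
        (((hg ⟨τ, hτ, e⟩ x).2).trans hux.symm)]
    · rintro ⟨τ, hτ⟩
      exact ⟨_, hτ, (hg τ x).2⟩
  rw [this]
  exact isOpen_iUnion fun τ => hO.preimage (hgc τ)

/-- The open star of a vertex `w` is evenly covered: its preimage is the disjoint union of the open
stars of the vertices over `w`. -/
theorem isCoveringMap_real : IsCoveringMap q.real := by
  intro z
  obtain ⟨w, hw⟩ := z.carrier_nonempty
  let F := {v : V // q v = w}
  let _ : TopologicalSpace F := ⊥
  have : DiscreteTopology F := ⟨rfl⟩
  refine IsEvenlyCovered.to_isEvenlyCovered_preimage (I := F) ⟨this, openStar L w, hw, isOpen_openStar w,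
    (isOpen_openStar w).preimage q.continuous_real, ?_⟩
  have hmem : ∀ x : q.real ⁻¹' openStar L w, ∃ v : F, v.1 ∈ x.1.carrier := by
    rintro ⟨x, hx⟩
    change w ∈ (q.real x).carrier at hx
    rw [q.carrier_real] at hx
    obtain ⟨v, hv, rfl⟩ := Finset.mem_image.1 hx
    exact ⟨⟨v, rfl⟩, hv⟩
  choose s hs using hmem
  have hs' : ∀ (x : q.real ⁻¹' openStar L w) (v : F), v.1 ∈ x.1.carrier → s x = v := fun x v hv =>
    Subtype.ext (hq.nonDegenerate _ x.1.support_mem (hs x) hv ((s x).2.trans v.2.symm))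
  let H : q.real ⁻¹' openStar L w → openStar L w × F := fun x => (⟨q.real x.1, x.2⟩, s x)
  have hbij : Function.Bijective H := by
    constructor
    · intro x y hxy
      have h1 : q.real x.1 = q.real y.1 := congrArg (fun a => a.1.1) hxy
      have h2 : s x = s y := congrArg Prod.snd hxy
      exact Subtype.ext (hq.eq_of_carrier (hs x) (h2 ▸ hs y) h1)
    · rintro ⟨⟨y, hy⟩, ⟨v, rfl⟩⟩
      obtain ⟨τ, hτ, hv, e⟩ := hq.exists_lift v _ y.support_mem hy
      obtain ⟨x, hx, rfl⟩ := q.exists_real_eq hτ e.symm.subset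
      refine ⟨⟨x, hy⟩, Prod.ext rfl (hs' _ _ ?_)⟩
      obtain ⟨u, hu, huv⟩ := Finset.mem_image.1 (q.carrier_real x ▸ hy : q v ∈ x.carrier.image q)
      exact (hq.nonDegenerate τ hτ (hx hu) hv huv) ▸ hu
  have hscont : Continuous s := by
    refine continuous_discrete_rng.2 fun v => ?_
    have : s ⁻¹' {v} = Subtype.val ⁻¹' openStar K v.1 := by
      ext x
      exact ⟨fun h => (show s x = v from h) ▸ hs x, fun h => hs' x v h⟩
    rw [this]
    exact (isOpen_openStar v.1).preimage continuous_subtype_val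
  have hcont : Continuous H :=
    ((q.continuous_real.comp continuous_subtype_val).subtype_mk _).prodMk hscont
  have hopen : IsOpenMap H := by
    intro O hO
    have : H '' O = ⋃ v : F, (Subtype.val ⁻¹' (q.real '' (Subtype.val '' O ∩ openStar K v.1))) ×ˢ {v} := by
      ext ⟨y, v⟩
      simp only [Set.mem_iUnion, Set.mem_prod, Set.mem_preimage, Set.mem_singleton_iff]
      constructor
      · rintro ⟨x, hx, e⟩
        obtain ⟨rfl, rfl⟩ := Prod.ext_iff.1 e
        exact ⟨s x, ⟨x.1, ⟨⟨x, hx, rfl⟩, hs x⟩, rfl⟩, rfl⟩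
      · rintro ⟨_, ⟨_, ⟨⟨x, hx, rfl⟩, hxs⟩, e⟩, rfl⟩
        exact ⟨x, hx, Prod.ext (Subtype.ext e) (hs' x _ hxs)⟩
    rw [this]
    refine isOpen_iUnion fun v => IsOpen.prod ?_ (isOpen_discrete _)
    refine (hq.isOpenMap_real _ (IsOpen.inter ?_ (isOpen_openStar _))).preimage continuous_subtype_val
    exact ((isOpen_openStar w).preimage q.continuous_real).isOpenMap_subtype_val _ hO
  exact ⟨(Equiv.ofBijective H hbij).toHomeomorphOfContinuousOpen hcont hopen, fun x => rfl⟩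

theorem injective [PathConnectedSpace (Realization K)] [SimplyConnectedSpace (Realization L)] :
    Function.Injective q := by
  intro v w h
  refine vert_injective (K := K) (hq.isCoveringMap_real.injective_of_simplyConnected ?_)
  rw [q.real_vert, q.real_vert, h]

end IsStarBijective

end SimplicialMap

end StarBijective

/-! ### The relations `Ψ` and `Φ` for maps that are surjective on stars. -/

section Unfolding

open Classical Realization

variable {V W : Type*} {K : AbstractSimplicialComplex V} {L : AbstractSimplicialComplex W}

/-- The image of a complex under a surjection of the vertices. -/
def AbstractSimplicialComplex.imageOfSurjective {Z : Type*} (K : AbstractSimplicialComplex V)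
    (π : V → Z) (hπ : Function.Surjective π) : AbstractSimplicialComplex Z where
  faces := {σ | ∃ τ ∈ K.faces, σ = τ.image π}
  isRelLowerSet_faces := by
    rintro σ ⟨τ, hτ, rfl⟩
    refine ⟨Finset.image_nonempty.mpr (K.isRelLowerSet_faces hτ).1, ?_⟩
    intro ρ hρ hne
    obtain ⟨τ', hτ', rfl⟩ := Finset.subset_image_iff.mp hρ
    exact ⟨τ', (K.isRelLowerSet_faces hτ).2 hτ' (Finset.image_nonempty.mp hne), rfl⟩
  singleton_mem := by
    intro z
    obtain ⟨v, rfl⟩ := hπ z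
    exact ⟨{v}, K.singleton_mem v, by simp⟩

namespace SimplicialMap

theorem phi_admissible (f : SimplicialMap K L) : f.Admissible f.Phi :=
  fun _ _ _ _ _ _ _ _ _ _ _ h => h

theorem sing_descend_phi (f : SimplicialMap K L) : Sing (f.descend f.Phi le_rfl) = ∅ := by
  rw [Set.eq_empty_iff_forall_notMem]
  intro x hx
  refine hx Set.univ Filter.univ_mem (Function.Injective.injOn ?_)
  intro a b
  induction a, b using Quotient.inductionOn₂ with
  | h a b => exact fun h => Quotient.sound h

theorem psi_le_phi (f : SimplicialMap K L) : f.Psi ≤ f.Phi :=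
  sInf_le ⟨f.phi_admissible, le_rfl, f.sing_descend_phi⟩

/-- Simplices with a pair of equivalent vertices and with the same image are identified by a
relation that kills all singularities. -/
theorem Admissible.rel_of_vert {f : SimplicialMap K L} (hf : f.NonDegenerate)
    {R : Setoid (Realization K)} (hR : f.Admissible R) (hRf : R ≤ f.Phi)
    (hs : Sing (f.descend R hRf) = ∅) {σ₁ σ₂ : Finset V} (h₁ : σ₁ ∈ K.faces) (h₂ : σ₂ ∈ K.faces)
    (h : σ₁.image f = σ₂.image f) {v₁ v₂ : V} (hv₁ : v₁ ∈ σ₁) (hv₂ : v₂ ∈ σ₂)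
    (hv : R (vert K v₁) (vert K v₂)) {y₁ y₂ : Realization K} (hy₁ : y₁.carrier ⊆ σ₁)
    (hy₂ : y₂.carrier ⊆ σ₂) (hy : f.real y₁ = f.real y₂) : R y₁ y₂ := by
  have hcard : σ₁.card = σ₂.card := by
    rw [← Finset.card_image_of_injOn (hf σ₁ h₁), ← Finset.card_image_of_injOn (hf σ₂ h₂), h]
  refine hR σ₁ h₁ σ₂ h₂ hcard h ?_ y₁ y₂ hy₁ hy₂ hy
  obtain ⟨z₁, hz₁⟩ := exists_carrier_eq h₁
  have hz : (f.real z₁).carrier = σ₁.image f := by rw [f.carrier_real, hz₁]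
  obtain ⟨z₂, hz₂, e⟩ := f.exists_real_eq h₂ (hz.trans h).subset
  have hz₂' : z₂.carrier = σ₂ := by
    refine Finset.eq_of_subset_of_card_le hz₂ ?_
    rw [← hcard, ← Finset.card_image_of_injOn (hf σ₁ h₁), ← hz, ← e, f.carrier_real]
    exact Finset.card_image_le
  obtain ⟨γ₁, hγ₁⟩ := exists_segment (K := K) h₁ (x := vert K v₁) (by simpa using hv₁) hz₁.subset
  obtain ⟨γ₂, hγ₂⟩ := exists_segment (K := K) h₂ (x := vert K v₂) (by simpa using hv₂) hz₂
  -- Both segments leave the common class of `v₁` and `v₂` and have the same image. Since the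
  -- induced map is injective near that class, the segments are `R`-equivalent at a small `t > 0`,
  -- where they run in the interiors of the two simplices; this is the input for admissibility.
  have hx : Quotient.mk R (vert K v₁) ∉ Sing (f.descend R hRf) := by rw [hs]; simp
  simp only [Sing, Set.mem_ofPred_eq, not_forall, not_not] at hx
  obtain ⟨U, hU, hinj⟩ := hx
  have hm₁ : ∀ᶠ t in nhds (0 : unitInterval), Quotient.mk R (γ₁ t) ∈ U := by
    have hc : Continuous fun t => Quotient.mk R (γ₁ t) :=
      continuous_quotient_mk'.comp γ₁.continuous
    refine hc.continuousAt.eventually_mem ?_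
    simpa using hU
  have hm₂ : ∀ᶠ t in nhds (0 : unitInterval), Quotient.mk R (γ₂ t) ∈ U := by
    have hc : Continuous fun t => Quotient.mk R (γ₂ t) :=
      continuous_quotient_mk'.comp γ₂.continuous
    refine hc.continuousAt.eventually_mem ?_
    rw [γ₂.source, ← Quotient.sound hv]
    exact hU
  have h4 : (nhdsWithin (0 : unitInterval) (Set.Ioi 0)).NeBot :=
    nhdsGT_neBot_of_exists_gt ⟨1, zero_lt_one⟩
  obtain ⟨t, ht, ht₁, ht₂⟩ := h4.nonempty_of_mem
    (inter_mem_nhdsWithin (Set.Ioi 0) (hm₁.and hm₂))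
  have hreal : f.real (γ₁ t) = f.real (γ₂ t) := by
    have hv' : f.real (vert K v₁) = f.real (vert K v₂) := hRf hv
    ext1
    rw [f.real_segment (hγ₁ t), f.real_segment (hγ₂ t), e, hv']
  refine ⟨γ₁ t, γ₂ t, ?_, ?_, hreal, Quotient.exact (hinj ht₁ ht₂ hreal)⟩
  · rw [carrier_of_segment ht (hγ₁ t) (by simpa [hz₁] using hv₁), hz₁]
  · rw [carrier_of_segment ht (hγ₂ t) (by simpa [hz₂'] using hv₂), hz₂']

/-- Surjectivity on stars makes the complex obtained from any competing relation cover the simply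
connected target, which leaves nothing more to identify. -/
theorem psi_eq_phi_of_exists_lift {f : SimplicialMap K L} (hf : f.NonDegenerate)
    (hlift : ∀ v, ∀ σ ∈ L.faces, f v ∈ σ → ∃ τ ∈ K.faces, v ∈ τ ∧ τ.image f = σ)
    [PathConnectedSpace (Realization K)] [SimplyConnectedSpace (Realization L)] :
    f.Psi = f.Phi := by
  refine f.psi_le_phi.antisymm (le_sInf ?_)
  rintro R ⟨hR, hRf, hs⟩
  let r : Setoid V := R.comap (vert K)
  have hrf : ∀ v w, r v w → f v = f w := by
    intro v w h
    have : f.real (vert K v) = f.real (vert K w) := hRf h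
    rw [f.real_vert, f.real_vert] at this
    exact vert_injective this
  have key : ∀ σ₁ ∈ K.faces, ∀ σ₂ ∈ K.faces, σ₁.image f = σ₂.image f → ∀ v₁ ∈ σ₁, ∀ v₂ ∈ σ₂,
      r v₁ v₂ → ∀ y₁ y₂ : Realization K, y₁.carrier ⊆ σ₁ → y₂.carrier ⊆ σ₂ →
      f.real y₁ = f.real y₂ → R y₁ y₂ := fun σ₁ h₁ σ₂ h₂ h v₁ hv₁ v₂ hv₂ hv y₁ y₂ hy₁ hy₂ hy =>
    hR.rel_of_vert hf hRf hs h₁ h₂ h hv₁ hv₂ hv hy₁ hy₂ hy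
  -- The quotient by `R` is modelled by the complex `Y` on the `R`-classes of vertices, through
  -- which `f` factors as `q ∘ π`.
  obtain ⟨Z, c, hcs, hcr⟩ : ∃ (Z : Type _) (c : V → Z), Function.Surjective c ∧
      ∀ v w, c v = c w ↔ r v w :=
    ⟨Quotient r, Quotient.mk r, Quotient.mk_surjective, fun v w => Quotient.eq⟩
  obtain ⟨g, hg⟩ : ∃ g : Z → W, ∀ v, g (c v) = f v :=
    ⟨fun z => f (Function.surjInv hcs z), fun v =>
      hrf _ _ ((hcr _ _).1 (Function.surjInv_eq hcs (c v)))⟩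
  let Y := K.imageOfSurjective c hcs
  let π : SimplicialMap K Y := ⟨c, fun σ hσ => ⟨σ, hσ, rfl⟩⟩
  have himage : ∀ τ : Finset V,
      (τ.image c).image g = τ.image f := by
    intro τ
    rw [Finset.image_image]
    exact Finset.image_congr fun v _ => hg v
  let q : SimplicialMap Y L := ⟨g, by
    rintro _ ⟨τ, hτ, rfl⟩
    rw [himage]
    exact f.map_faces τ hτ⟩
  have hq : q.IsStarBijective := by
    refine ⟨?_, ?_, ?_⟩
    · rintro _ ⟨τ, hτ, rfl⟩ a ha b hb hab
      obtain ⟨v, hv, rfl⟩ := Finset.mem_image.1 ha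
      obtain ⟨w, hw, rfl⟩ := Finset.mem_image.1 hb
      rw [hf τ hτ hv hw ((hg v).symm.trans (Eq.trans hab (hg w)))]
    · intro a σ hσ ha
      obtain ⟨v, rfl⟩ := hcs a
      obtain ⟨τ, hτ, hv, rfl⟩ := hlift v σ hσ (hg v ▸ ha)
      exact ⟨_, ⟨τ, hτ, rfl⟩, Finset.mem_image_of_mem _ hv, himage τ⟩
    · rintro a _ ⟨τ₁, h₁, rfl⟩ _ ⟨τ₂, h₂, rfl⟩ ha₁ ha₂ h
      have h' : τ₁.image f = τ₂.image f := (himage τ₁).symm.trans (h.trans (himage τ₂))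
      obtain ⟨v₁, hv₁, rfl⟩ := Finset.mem_image.1 ha₁
      obtain ⟨v₂, hv₂, hv⟩ := Finset.mem_image.1 ha₂
      have hr : r v₁ v₂ := r.symm ((hcr _ _).1 hv)
      -- By `key`, simplices with the same image and a common class of vertices have equivalent
      -- vertices throughout, so they coincide in `Y`.
      have hsub : ∀ σ₁ ∈ K.faces, ∀ σ₂ ∈ K.faces, σ₁.image f = σ₂.image f → ∀ v₁ ∈ σ₁,
          ∀ v₂ ∈ σ₂, r v₁ v₂ → σ₁.image c ⊆ σ₂.image c := by
        intro σ₁ h₁ σ₂ h₂ h v₁ hv₁ v₂ hv₂ hv a ha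
        obtain ⟨u, hu, rfl⟩ := Finset.mem_image.1 ha
        obtain ⟨w, hw, hwu⟩ := Finset.mem_image.1 (h ▸ Finset.mem_image_of_mem f hu)
        refine Finset.mem_image.2 ⟨w, hw, (hcr _ _).2 (r.symm ?_)⟩
        refine key σ₁ h₁ σ₂ h₂ h v₁ hv₁ v₂ hv₂ hv _ _ (by simpa using hu) (by simpa using hw) ?_
        rw [f.real_vert, f.real_vert, hwu]
      exact (hsub τ₁ h₁ τ₂ h₂ h' v₁ hv₁ v₂ hv₂ hr).antisymm
        (hsub τ₂ h₂ τ₁ h₁ h'.symm v₂ hv₂ v₁ hv₁ (r.symm hr))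
  have hπ : Function.Surjective π.real := by
    intro y
    obtain ⟨τ, hτ, e⟩ := y.support_mem
    obtain ⟨x, _, hx⟩ := π.exists_real_eq hτ (y := y) e.subset
    exact ⟨x, hx⟩
  have : PathConnectedSpace (Realization Y) := hπ.pathConnectedSpace π.continuous_real
  have hinj := hq.injective
  intro x₁ x₂ hx
  have hx' : f.real x₁ = f.real x₂ := hx
  have hc : x₁.carrier.image f = x₂.carrier.image f := by
    rw [← f.carrier_real, ← f.carrier_real, hx']
  obtain ⟨v₁, hv₁⟩ := x₁.carrier_nonempty
  obtain ⟨v₂, hv₂, hv⟩ := Finset.mem_image.1 (hc ▸ Finset.mem_image_of_mem f hv₁)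
  have hr : r v₂ v₁ := (hcr _ _).1 (hinj ((hg v₂).trans (Eq.trans hv (hg v₁).symm)))
  exact key _ x₁.support_mem _ x₂.support_mem hc v₁ hv₁ v₂ hv₂ (r.symm hr) x₁ x₂ subset_rfl
    subset_rfl hx'

end SimplicialMap

end Unfolding

/-! ### Enumerations and rooted trees. -/

section Trees

/-- The rank of `a` encodes the sum of the ranks of its finitely many predecessors, which forces
monotonicity, paired with an injective label of `a`, which forces injectivity. -/
theorem exists_injective_rank {α : Type*} [Countable α] (r : α → α → Prop) (wf : WellFounded r)
    (fin : ∀ a, {b | r b a}.Finite) :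
    ∃ rank : α → ℕ, Function.Injective rank ∧ ∀ a b, r b a → rank b < rank a := by
  obtain ⟨e, he⟩ := exists_injective_nat α
  let rank : α → ℕ := wf.fix fun a ih =>
    Nat.pair (∑ b ∈ (fin a).toFinset.attach, ih b.1 ((fin a).mem_toFinset.1 b.2)) (e a) + 1
  have hrank : ∀ a, rank a =
      Nat.pair (∑ b ∈ (fin a).toFinset.attach, rank b.1) (e a) + 1 := fun a => wf.fix_eq _ a
  refine ⟨rank, ?_, ?_⟩
  · intro a b h
    rw [hrank, hrank, Nat.succ_inj, Nat.pair_eq_pair] at h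
    exact he h.2
  · intro a b h
    rw [hrank a, Nat.lt_succ_iff]
    refine le_trans ?_ (Nat.left_le_pair _ _)
    exact Finset.single_le_sum (f := fun b : {b // b ∈ (fin a).toFinset} => rank b.1)
      (fun _ _ => Nat.zero_le _) (Finset.mem_attach _ ⟨b, (fin a).mem_toFinset.2 h⟩)

namespace SimpleGraph

variable {Y : Type*} {G : SimpleGraph Y}

/-- Descending to parents gives connectedness. On a cycle, the two distinct neighbours of a vertex
of maximal height would both be its parent. Heights in a general well-order allow lexicographic
pairs. -/
theorem isTree_of_parent {α : Type*} [LinearOrder α] [WellFoundedLT α] (root : Y) (par : Y → Y)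
    (h : Y → α) (h1 : ∀ y, y ≠ root → G.Adj y (par y) ∧ h (par y) < h y)
    (h2 : ∀ x y, G.Adj x y → (x ≠ root ∧ par x = y) ∨ (y ≠ root ∧ par y = x)) : G.IsTree := by
  classical
  have hr : ∀ y, G.Reachable root y := by
    intro y
    induction hy : h y using WellFoundedLT.induction generalizing y with
    | ind a ih =>
      by_cases hroot : y = root
      · rw [hroot]
      · exact (ih _ (hy ▸ (h1 y hroot).2) (par y) rfl).trans (h1 y hroot).1.symm.reachable
  have : Nonempty Y := ⟨root⟩
  refine ⟨⟨fun x y => (hr x).symm.trans (hr y)⟩, ?_⟩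
  intro v c hc
  obtain ⟨m, hm, hmax⟩ := c.support.toFinset.exists_max_image h
    ⟨v, by rw [List.mem_toFinset]; exact c.start_mem_support⟩
  rw [List.mem_toFinset] at hm
  have hc' := hc.rotate hm
  have hsupp : ∀ x ∈ (c.rotate m hm).support, h x ≤ h m := fun x hx =>
    hmax x (by rw [List.mem_toFinset]; simpa using hx)
  have hpar : ∀ x ∈ (c.rotate m hm).support, G.Adj m x → par m = x := by
    intro x hx hadj
    rcases h2 m x hadj with h | h
    · exact h.2
    · exact absurd ((h1 x h.1).2) (not_lt.2 (h.2 ▸ hsupp x hx))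
  refine hc'.snd_ne_penultimate ?_
  exact (hpar _ (Walk.getVert_mem_support _ _) (Walk.adj_snd hc'.not_nil)).symm.trans
    (hpar _ (Walk.getVert_mem_support _ _) (Walk.adj_penultimate hc'.not_nil).symm)

/-- The parent is the penultimate vertex of the unique path from the root. Every walk from the root
contains that path; this last property later keeps parents inside connected subgraphs. -/
theorem IsTree.exists_parent (hG : G.IsTree) (root : Y) : ∃ (par : Y → Y) (h : Y → ℕ),
    (∀ y, y ≠ root → G.Adj y (par y) ∧ h (par y) < h y) ∧
    (∀ x y, G.Adj x y → (x ≠ root ∧ par x = y) ∨ (y ≠ root ∧ par y = x)) ∧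
    ∀ y, y ≠ root → ∀ w : G.Walk root y, par y ∈ w.support := by
  classical
  choose p hp hp' using fun y => hG.existsUnique_path root y
  have hnil : ∀ y, y ≠ root → ¬ (p y).Nil := fun y hy h => hy h.eq.symm
  refine ⟨fun y => (p y).penultimate, fun y => G.dist root y, ?_, ?_, ?_⟩
  · intro y hy
    refine ⟨(Walk.adj_penultimate (hnil y hy)).symm, ?_⟩
    obtain ⟨q, hq, hql⟩ := hG.connected.exists_path_of_dist root y
    have hqp : q = p y := hp' y q hq
    have h1 : G.dist root (p y).penultimate ≤ (p y).dropLast.length := dist_le _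
    have h2 : (p y).dropLast.length + 1 = (p y).length := by
      rw [← Walk.length_concat _ (Walk.adj_penultimate (hnil y hy)), Walk.concat_dropLast]
    rw [hqp] at hql
    change G.dist root (p y).penultimate < G.dist root y
    omega
  · intro x y hadj
    by_cases hx : x ∈ (p y).support
    · refine Or.inr ⟨?_, (hG.isAcyclic.eq_penultimate_of_adj_end (hp y) hadj.symm hx).symm⟩
      rintro rfl
      have := hp' y Walk.nil (by simp)
      rw [← this] at hx
      simp only [Walk.support_nil, List.mem_singleton] at hx
      exact hadj.ne hx
    · have hy := hG.isAcyclic.mem_support_of_ne_mem_support_of_adj_of_isPath (hp x) (hp y) hadj hx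
      refine Or.inl ⟨?_, (hG.isAcyclic.eq_penultimate_of_adj_end (hp x) hadj hy).symm⟩
      rintro rfl
      have := hp' x Walk.nil (by simp)
      rw [← this] at hy
      simp only [Walk.support_nil, List.mem_singleton] at hy
      exact hadj.ne hy.symm
  · intro y hy w
    have : w.bypass = p y := hp' y _ w.bypass_isPath
    refine w.support_bypass_subset_support ?_
    rw [this]
    exact Walk.getVert_mem_support _ _

end SimpleGraph

end Trees

/-! ### Building and rooting gsc decompositions. -/

section GSC

open Classical

variable {V : Type*}

theorem PreAbstractSimplicialComplex.singleton_mem_of_mem {K : PreAbstractSimplicialComplex V}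
    {σ : Finset V} (hσ : σ ∈ K.faces) {v : V} (hv : v ∈ σ) : {v} ∈ K.faces :=
  (K.isRelLowerSet_faces hσ).2 (Finset.singleton_subset_iff.2 hv) (Finset.singleton_nonempty v)

/-- A decomposition is determined by the tree, the 2-cells paired with the other edges, and an
enumeration of the other edges that is compatible with the incidences. -/
def GSCDecomposition.ofRank (K : PreAbstractSimplicialComplex V) (tree : Set (Finset V))
    (tree_mem : ∀ e ∈ tree, e ∈ K.faces ∧ e.card = 2) (isTree : (edgeGraph K tree).IsTree)
    (φ : {e : Finset V // e ∈ K.faces ∧ e.card = 2 ∧ e ∉ tree} → Finset V)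
    (hφ : ∀ e, φ e ∈ K.faces ∧ (φ e).card = 3 ∧ e.1 ⊆ φ e)
    (rank : {e : Finset V // e ∈ K.faces ∧ e.card = 2 ∧ e ∉ tree} → ℕ)
    (rank_inj : Function.Injective rank)
    (rank_lt : ∀ e e', e' ≠ e → e'.1 ⊆ φ e → rank e' < rank e) : GSCDecomposition K where
  tree := tree
  idx := Set.range rank
  H1 := Function.extend rank (fun e => e.1) fun _ => ∅
  H2 := Function.extend rank φ fun _ => ∅
  tree_mem := tree_mem
  isTree := isTree
  H1_mem := by
    rintro _ ⟨e, rfl⟩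
    rw [rank_inj.extend_apply]
    exact e.2
  H1_injOn := by
    rintro _ ⟨e, rfl⟩ _ ⟨e', rfl⟩ h
    rw [rank_inj.extend_apply, rank_inj.extend_apply] at h
    rw [Subtype.ext h]
  H1_exhaust := fun e h1 h2 h3 => ⟨_, ⟨⟨e, h1, h2, h3⟩, rfl⟩, rank_inj.extend_apply _ _ _⟩
  H2_mem := by
    rintro _ ⟨e, rfl⟩
    rw [rank_inj.extend_apply]
    exact ⟨(hφ e).1, (hφ e).2.1⟩
  H2_injOn := by
    rintro _ ⟨e, rfl⟩ _ ⟨e', rfl⟩ h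
    rw [rank_inj.extend_apply, rank_inj.extend_apply] at h
    -- Two edges paired with the same 2-simplex would each have to precede the other.
    by_contra hne
    have hne' : e ≠ e' := fun h => hne (h ▸ rfl)
    exact (rank_lt e e' hne'.symm (h ▸ (hφ e').2.2)).asymm
      (rank_lt e' e hne' (h ▸ (hφ e).2.2))
  matrix := by
    rintro _ ⟨e, rfl⟩ _ ⟨e', rfl⟩
    rw [rank_inj.extend_apply, rank_inj.extend_apply, intersectionNumber]
    by_cases h : e = e'
    · subst h
      exact ⟨0, by simp [(hφ e).2.2], by simp⟩
    · refine ⟨if e'.1 ⊆ φ e then 1 else 0, by simp [rank_inj.eq_iff, h], fun ha => ?_⟩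
      refine rank_lt e e' (Ne.symm h) ?_
      by_contra hn
      simp [hn] at ha

theorem GSCDecomposition.H1_subset_H2 {K : PreAbstractSimplicialComplex V} (D : GSCDecomposition K)
    {i : ℕ} (hi : i ∈ D.idx) : D.H1 i ⊆ D.H2 i := by
  obtain ⟨a, ha, _⟩ := D.matrix i hi i hi
  by_contra h
  simp [intersectionNumber, h] at ha
  omega

theorem GSCDecomposition.lt_of_subset {K : PreAbstractSimplicialComplex V}
    (D : GSCDecomposition K) {i j : ℕ} (hi : i ∈ D.idx) (hj : j ∈ D.idx) (hne : i ≠ j)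
    (h : D.H1 i ⊆ D.H2 j) : i < j := by
  obtain ⟨a, ha, ha'⟩ := D.matrix j hj i hi
  refine ha' ?_
  simp [intersectionNumber, h, hne.symm] at ha
  omega

/-- The tree of a decomposition, rooted at a vertex of a subcomplex that it meets in a connected
graph. -/
theorem GSCDecomposition.exists_parent {K L : PreAbstractSimplicialComplex V}
    (D : GSCDecomposition K) (hL : L ≤ K)
    (hc : (edgeGraph L {e | e ∈ D.tree ∧ e ∈ L.faces}).Connected) :
    ∃ (s : V) (π : V → V) (h : V → ℕ), {s} ∈ L.faces ∧
      (∀ v, {v} ∈ K.faces → v ≠ s → {π v} ∈ K.faces ∧ v ≠ π v ∧ {v, π v} ∈ D.tree ∧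
        h (π v) < h v ∧ ({v} ∈ L.faces → {π v} ∈ L.faces)) ∧
      ∀ v w, {v} ∈ K.faces → {w} ∈ K.faces → v ≠ w → {v, w} ∈ D.tree →
        (v ≠ s ∧ π v = w) ∨ (w ≠ s ∧ π w = v) := by
  obtain ⟨s⟩ := hc.nonempty
  have hsK : {s.1} ∈ K.faces := hL s.2
  obtain ⟨π, h, h1, h2, h3⟩ := D.isTree.exists_parent ⟨s.1, hsK⟩
  obtain ⟨π', hπ⟩ : ∃ π' : V → V, ∀ v (hv : ({v} : Finset V) ∈ K.faces), π' v = (π ⟨v, hv⟩).1 :=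
    ⟨fun v => if hv : {v} ∈ K.faces then (π ⟨v, hv⟩).1 else v, fun v hv => dif_pos hv⟩
  obtain ⟨h', hh⟩ : ∃ h' : V → ℕ, ∀ v : {v : V // ({v} : Finset V) ∈ K.faces}, h' v.1 = h v :=
    ⟨fun v => if hv : {v} ∈ K.faces then h ⟨v, hv⟩ else 0, fun v => dif_pos v.2⟩
  refine ⟨s.1, π', h', s.2, ?_, ?_⟩
  · intro v hv hvs
    have hvs' : (⟨v, hv⟩ : {v // {v} ∈ K.faces}) ≠ ⟨s.1, hsK⟩ := fun h => hvs (congrArg Subtype.val h)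
    obtain ⟨⟨hne, htree⟩, hlt⟩ := h1 _ hvs'
    rw [hπ v hv, hh, hh ⟨v, hv⟩]
    refine ⟨(π ⟨v, hv⟩).2, fun h => hne (Subtype.ext h), htree, hlt, ?_⟩
    · intro hvL
      -- A walk inside `L` from the root to `v` passes through the parent of `v`, which is therefore
      -- in `L`.
      obtain ⟨w⟩ := hc.preconnected s ⟨v, hvL⟩
      let ι : edgeGraph L {e | e ∈ D.tree ∧ e ∈ L.faces} →g edgeGraph K D.tree :=
        ⟨fun u => ⟨u.1, hL u.2⟩, fun {a b} hab =>
          ⟨fun h => hab.1 (Subtype.ext (Subtype.mk.inj h)), hab.2.1⟩⟩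
      have := h3 _ hvs' (w.map ι)
      rw [SimpleGraph.Walk.support_map, List.mem_map] at this
      obtain ⟨u, _, hu⟩ := this
      rw [← hu]
      exact u.2
  · intro v w hv hw hne htree
    rw [hπ v hv, hπ w hw]
    rcases h2 ⟨v, hv⟩ ⟨w, hw⟩ ⟨fun h => hne (congrArg Subtype.val h), htree⟩ with h | h
    · exact Or.inl ⟨fun h' => h.1 (Subtype.ext h'), congrArg Subtype.val h.2⟩
    · exact Or.inr ⟨fun h' => h.1 (Subtype.ext h'), congrArg Subtype.val h.2⟩

end GSC

/-! ### Trees of gsc pieces are gsc. -/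

section PieceTree

open Classical

/-- A complex that is obtained from pieces by gluing them in the pattern of a rooted tree, each
piece `piece j` being glued to the preceding one `piece (par j)` along the full subcomplex `face j`.
The map `F` restricts to an isomorphism from the copy `mem j` of `piece j` to `piece j`, and
`home y` is the first piece that contains the vertex `y`. -/
structure PieceTree (V J Y : Type*) where
  X : AbstractSimplicialComplex Y
  F : Y → V
  root : J
  par : J → J
  ht : J → ℕ
  piece : J → PreAbstractSimplicialComplex V
  face : J → PreAbstractSimplicialComplex V
  mem : J → Set Y
  home : Y → J
  ht_par : ∀ j, j ≠ root → ht (par j) < ht j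
  face_le : ∀ j, j ≠ root → face j ≤ piece j
  face_le_par : ∀ j, j ≠ root → face j ≤ piece (par j)
  full : ∀ j, j ≠ root → ∀ σ ∈ (piece j).faces, (∀ v ∈ σ, {v} ∈ (face j).faces) →
    σ ∈ (face j).faces
  injOn : ∀ j, Set.InjOn F (mem j)
  surj : ∀ j v, {v} ∈ (piece j).faces → ∃ y ∈ mem j, F y = v
  mem_piece : ∀ j, ∀ y ∈ mem j, {F y} ∈ (piece j).faces
  faces_iff : ∀ S : Finset Y, S ∈ X.faces ↔ ∃ j, (S : Set Y) ⊆ mem j ∧ S.image F ∈ (piece j).faces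
  mem_home : ∀ y, y ∈ mem (home y)
  home_cases : ∀ j, ∀ y ∈ mem j,
    j = home y ∨ (j ≠ root ∧ {F y} ∈ (face j).faces ∧ y ∈ mem (par j))
  home_root : ∀ y, home y = root ∨ {F y} ∉ (face (home y)).faces

namespace PieceTree

variable {V J Y : Type*} (P : PieceTree V J Y)

theorem ht_home (j : J) (y : Y) (hy : y ∈ P.mem j) : P.home y = j ∨ P.ht (P.home y) < P.ht j := by
  induction hn : P.ht j using Nat.strong_induction_on generalizing j with
  | _ n ih =>
    subst hn
    rcases P.home_cases j y hy with h | ⟨h1, _, h3⟩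
    · exact Or.inl h.symm
    · have hlt := P.ht_par j h1
      rcases ih _ hlt (P.par j) h3 rfl with h | h
      · exact Or.inr (h ▸ hlt)
      · exact Or.inr (h.trans hlt)

/-- `j` is the first piece that contains the simplex `S`. -/
def IsHome (j : J) (S : Finset Y) : Prop :=
  (S : Set Y) ⊆ P.mem j ∧ S.image P.F ∈ (P.piece j).faces ∧ ∃ y ∈ S, P.home y = j

variable {P}

theorem IsHome.mem_faces {j : J} {S : Finset Y} (h : P.IsHome j S) : S ∈ P.X.faces :=
  (P.faces_iff S).2 ⟨j, h.1, h.2.1⟩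

theorem IsHome.eq_or_lt {j j' : J} {S S' : Finset Y} (h : P.IsHome j S) (h' : P.IsHome j' S')
    (hS : S ⊆ S') : j = j' ∨ P.ht j < P.ht j' := by
  obtain ⟨y, hy, rfl⟩ := h.2.2
  exact P.ht_home j' y (h'.1 (hS hy))

/-- If all vertices had an earlier home, they would lie in the face, and fullness would put the
whole simplex there. -/
theorem isHome_of_notMem_face {j : J} {S : Finset Y} (h1 : (S : Set Y) ⊆ P.mem j)
    (h2 : S.image P.F ∈ (P.piece j).faces) (h3 : j = P.root ∨ S.image P.F ∉ (P.face j).faces) :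
    P.IsHome j S := by
  refine ⟨h1, h2, ?_⟩
  by_contra hcon
  have hc : ∀ y ∈ S, j ≠ P.root ∧ {P.F y} ∈ (P.face j).faces := by
    intro y hy
    rcases P.home_cases j y (h1 hy) with h | h
    · exact absurd ⟨y, hy, h.symm⟩ hcon
    · exact ⟨h.1, h.2.1⟩
  obtain ⟨y, hy⟩ : S.Nonempty :=
    Finset.image_nonempty.1 ((P.piece j).isRelLowerSet_faces h2).1
  have hj := (hc y hy).1
  refine h3.elim hj fun h3 => h3 (P.full j hj _ h2 ?_)
  intro v hv
  obtain ⟨x, hx, rfl⟩ := Finset.mem_image.1 hv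
  exact (hc x hx).2

theorem IsHome.notMem_face {j : J} {S : Finset Y} (h : P.IsHome j S) (hj : j ≠ P.root) :
    S.image P.F ∉ (P.face j).faces := by
  obtain ⟨y, hy, rfl⟩ := h.2.2
  intro hf
  exact (P.home_root y).elim hj fun h' => h'
    (PreAbstractSimplicialComplex.singleton_mem_of_mem hf (Finset.mem_image_of_mem _ hy))

theorem exists_isHome {S : Finset Y} (hS : S ∈ P.X.faces) : ∃ j, P.IsHome j S := by
  obtain ⟨j, h1, h2⟩ := (P.faces_iff S).1 hS
  induction hn : P.ht j using Nat.strong_induction_on generalizing j with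
  | _ n ih =>
    subst hn
    by_cases h3 : j = P.root ∨ S.image P.F ∉ (P.face j).faces
    · exact ⟨j, isHome_of_notMem_face h1 h2 h3⟩
    · push Not at h3
      by_cases hex : ∃ y ∈ S, P.home y = j
      · exact ⟨j, h1, h2, hex⟩
      · refine ih _ (P.ht_par j h3.1) (P.par j) ?_ (P.face_le_par j h3.1 h3.2) rfl
        intro y hy
        rcases P.home_cases j y (h1 hy) with h | h
        · exact absurd ⟨y, hy, h.symm⟩ hex
        · exact h.2.2

theorem exists_lift {j : J} {σ : Finset V} (hσ : σ ∈ (P.piece j).faces) :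
    ∃ S : Finset Y, (S : Set Y) ⊆ P.mem j ∧ S.image P.F = σ := by
  obtain ⟨S, hS⟩ := Finset.subset_set_image_iff.1 (show (σ : Set V) ⊆ P.F '' P.mem j from
    fun v hv => P.surj j v (PreAbstractSimplicialComplex.singleton_mem_of_mem hσ hv))
  exact ⟨S, hS⟩

variable (P) in
/-- The edges of `X` that belong to the tree of the first piece that contains them. -/
def tree (D : ∀ j, GSCDecomposition (P.piece j)) : Set (Finset Y) :=
  {S | S.card = 2 ∧ ∃ j, P.IsHome j S ∧ S.image P.F ∈ (D j).tree}

/-- The parent of a vertex is taken in the tree of its home piece. The edges so obtained are exactly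
those of the union of the trees, because each face meets the tree of its piece in a connected graph.
-/
theorem isTree_edgeGraph (D : ∀ j, GSCDecomposition (P.piece j))
    (hD : ∀ j, j ≠ P.root →
      (edgeGraph (P.face j) {e | e ∈ (D j).tree ∧ e ∈ (P.face j).faces}).IsTree) :
    (edgeGraph P.X.toPreAbstractSimplicialComplex (P.tree D)).IsTree := by
  -- The tree of a non-root piece is rooted in its face, so that parents of vertices of the face
  -- remain in the face.
  have key : ∀ j, ∃ (s : V) (π : V → V) (h : V → ℕ),
      ({s} : Finset V) ∈ (P.piece j).faces ∧ (j ≠ P.root → {s} ∈ (P.face j).faces) ∧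
      (∀ v, {v} ∈ (P.piece j).faces → v ≠ s → {π v} ∈ (P.piece j).faces ∧ v ≠ π v ∧
        {v, π v} ∈ (D j).tree ∧ h (π v) < h v ∧
        (j ≠ P.root → {v} ∈ (P.face j).faces → {π v} ∈ (P.face j).faces)) ∧
      ∀ v w, {v} ∈ (P.piece j).faces → {w} ∈ (P.piece j).faces → v ≠ w → {v, w} ∈ (D j).tree →
        (v ≠ s ∧ π v = w) ∨ (w ≠ s ∧ π w = v) := by
    intro j
    by_cases hj : j = P.root
    · have he : {e | e ∈ (D j).tree ∧ e ∈ (P.piece j).faces} = (D j).tree := by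
        ext e
        exact ⟨fun h => h.1, fun h => ⟨h, ((D j).tree_mem e h).1⟩⟩
      obtain ⟨s, π, h, h1, h2, h3⟩ := (D j).exists_parent le_rfl
        (he.symm ▸ (D j).isTree.connected)
      refine ⟨s, π, h, h1, fun h => absurd hj h, fun v hv hvs => ?_, h3⟩
      obtain ⟨a, b, c, d, _⟩ := h2 v hv hvs
      exact ⟨a, b, c, d, fun h => absurd hj h⟩
    · obtain ⟨s, π, h, h1, h2, h3⟩ := (D j).exists_parent (P.face_le j hj) (hD j hj).connected
      refine ⟨s, π, h, P.face_le j hj h1, fun _ => h1, fun v hv hvs => ?_, h3⟩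
      obtain ⟨a, b, c, d, e⟩ := h2 v hv hvs
      exact ⟨a, b, c, d, fun _ => e⟩
  choose s π h hs hsf hπ hadj using key
  obtain ⟨y₀, hy₀, hFy₀⟩ := P.surj P.root _ (hs P.root)
  have hhome₀ : P.home y₀ = P.root := by
    rcases P.home_cases _ _ hy₀ with h | h
    · exact h.symm
    · exact absurd rfl h.1
  -- The root of the tree of a non-root piece lies in the face, hence has an earlier home. So `y₀`
  -- is the only vertex that is the root in its own home.
  have hroot : ∀ y, y = y₀ ↔ P.F y = s (P.home y) := by
    intro y
    constructor
    · rintro rfl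
      rw [hhome₀, hFy₀]
    · intro hy
      have hh : P.home y = P.root := by
        by_contra hne
        exact (P.home_root y).elim hne fun h' => h' (hy ▸ hsf _ hne)
      refine P.injOn P.root (hh ▸ P.mem_home y) hy₀ ?_
      rw [hy, hFy₀, hh]
  have hpar : ∀ y, ∃ y', y ≠ y₀ → y' ∈ P.mem (P.home y) ∧ P.F y' = π (P.home y) (P.F y) := by
    intro y
    by_cases hy : y = y₀
    · exact ⟨y, fun h => absurd hy h⟩
    · obtain ⟨y', hy', e⟩ := P.surj _ _ (hπ (P.home y) (P.F y)
        (P.mem_piece _ y (P.mem_home y)) fun h => hy ((hroot y).2 h)).1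
      exact ⟨y', fun _ => ⟨hy', e⟩⟩
  choose par hpar using hpar
  -- A parent either has an earlier home, or the same home and smaller height in the tree there.
  refine SimpleGraph.isTree_of_parent (α := ℕ ×ₗ ℕ) ⟨y₀, P.X.singleton_mem y₀⟩
    (fun y => ⟨par y.1, P.X.singleton_mem _⟩)
    (fun y => toLex (P.ht (P.home y.1), h (P.home y.1) (P.F y.1))) ?_ ?_
  · rintro ⟨y, _⟩ hy
    have hy' : y ≠ y₀ := fun h => hy (Subtype.ext h)
    obtain ⟨hm, hF⟩ := hpar y hy'
    obtain ⟨h1, h2, h3, h4, _⟩ := hπ (P.home y) (P.F y)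
        (P.mem_piece _ y (P.mem_home y)) fun h => hy' ((hroot y).2 h)
    have hne : y ≠ par y := fun h => h2 (by rw [← hF, ← h])
    refine ⟨⟨fun h => hne (congrArg Subtype.val h), Finset.card_pair hne, P.home y, ⟨?_, ?_, ?_⟩, ?_⟩, ?_⟩
    · intro x hx
      simp only [Finset.coe_insert, Finset.coe_singleton, Set.mem_insert_iff,
        Set.mem_singleton_iff] at hx
      rcases hx with rfl | rfl
      · exact P.mem_home x
      · exact hm
    · rw [Finset.image_insert, Finset.image_singleton, hF]
      exact ((D _).tree_mem _ h3).1
    · exact ⟨y, by simp, rfl⟩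
    · rw [Finset.image_insert, Finset.image_singleton, hF]
      exact h3
    · rw [Prod.Lex.toLex_lt_toLex]
      rcases P.ht_home _ _ hm with e | hlt
      · refine Or.inr ⟨congrArg P.ht e, ?_⟩
        dsimp only
        rw [e, hF]
        exact h4
      · exact Or.inl hlt
  · rintro ⟨x, hx⟩ ⟨y, hy⟩ ⟨hne, hcard, j, hj, htree⟩
    have hne' : x ≠ y := fun h => hne (Subtype.ext h)
    have hxm : x ∈ P.mem j := hj.1 (by simp)
    have hym : y ∈ P.mem j := hj.1 (by simp)
    dsimp only at hj htree
    -- If the lower end `y` is the parent of `x` in the tree of `j`, then `j` is the home of `x`: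
    -- otherwise `x`, its parent and, by fullness, the edge would lie in the face.
    have key : ∀ x y : Y, x ∈ P.mem j → y ∈ P.mem j → P.IsHome j {x, y} →
        P.F x ≠ s j → π j (P.F x) = P.F y → x ≠ y₀ ∧ par x = y := by
      intro x y hx hy hj hs' e
      have hh : j = P.home x := by
        rcases P.home_cases j x hx with h | ⟨h1, h2, _⟩
        · exact h
        · refine absurd (P.full j h1 _ hj.2.1 ?_) (hj.notMem_face h1)
          intro v hv
          simp only [Finset.image_insert, Finset.image_singleton, Finset.mem_insert,
            Finset.mem_singleton] at hv
          rcases hv with rfl | rfl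
          · exact h2
          · rw [← e]
            exact (hπ j (P.F x) (P.mem_piece j x hx) hs').2.2.2.2 h1 h2
      have hx₀ : x ≠ y₀ := fun h => hs' (hh ▸ (hroot x).1 h)
      obtain ⟨hm, hF⟩ := hpar x hx₀
      rw [← hh] at hm hF
      exact ⟨hx₀, P.injOn j hm hy (hF.trans e)⟩
    rw [Finset.image_insert, Finset.image_singleton] at htree
    rcases hadj j (P.F x) (P.F y) (P.mem_piece j x hxm) (P.mem_piece j y hym)
      (fun h => hne' (P.injOn j hxm hym h)) htree with h | h
    · obtain ⟨a, b⟩ := key x y hxm hym hj h.1 h.2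
      exact Or.inl ⟨fun h => a (congrArg Subtype.val h), Subtype.ext b⟩
    · obtain ⟨a, b⟩ := key y x hym hxm (Finset.pair_comm x y ▸ hj) h.1 h.2
      exact Or.inr ⟨fun h => a (congrArg Subtype.val h), Subtype.ext b⟩

/-- An edge of the triangle has the same home as the triangle, where the incidence matrix of that
piece decides, or an earlier one. -/
theorem IsHome.lt_of_subset {D : ∀ j, GSCDecomposition (P.piece j)} {j j' : J} {i i' : ℕ}
    {S S' S₂ : Finset Y} (hi : i ∈ (D j).idx) (hi' : i' ∈ (D j').idx)
    (hS : P.IsHome j S) (hS' : P.IsHome j' S') (hS₂ : P.IsHome j S₂)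
    (e : (D j).H1 i = S.image P.F) (e' : (D j').H1 i' = S'.image P.F)
    (e₂ : S₂.image P.F = (D j).H2 i) (hne : S' ≠ S) (hsub : S' ⊆ S₂) :
    toLex (P.ht j', i') < toLex (P.ht j, i) := by
  rw [Prod.Lex.toLex_lt_toLex]
  rcases hS'.eq_or_lt hS₂ hsub with h | h
  · subst h
    refine Or.inr ⟨rfl, (D j').lt_of_subset hi' hi ?_ ?_⟩
    · rintro rfl
      refine hne (Finset.coe_injective ?_)
      refine (P.injOn j').image_eq_image_iff hS'.1 hS.1 |>.1 ?_
      rw [← Finset.coe_image, ← Finset.coe_image, ← e, ← e']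
    · rw [e', ← e₂]
      exact Finset.image_subset_image hsub
  · exact Or.inl h

/-- An edge outside the tree is paired with the lift of the triangle assigned to it in its home. -/
theorem isGSC [Countable Y] (D : ∀ j, GSCDecomposition (P.piece j))
    (hD : ∀ j, j ≠ P.root →
      (edgeGraph (P.face j) {e | e ∈ (D j).tree ∧ e ∈ (P.face j).faces}).IsTree) :
    IsGSC P.X.toPreAbstractSimplicialComplex := by
  have key : ∀ e : {e : Finset Y // e ∈ P.X.faces ∧ e.card = 2 ∧ e ∉ P.tree D},
      ∃ (j : J) (i : ℕ) (S₂ : Finset Y), P.IsHome j e.1 ∧ P.IsHome j S₂ ∧ i ∈ (D j).idx ∧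
        (D j).H1 i = e.1.image P.F ∧ S₂.image P.F = (D j).H2 i := by
    rintro ⟨S, hS, hcard, htree⟩
    obtain ⟨j, hj⟩ := exists_isHome hS
    have hc : (S.image P.F).card = 2 := by
      rw [Finset.card_image_of_injOn ((P.injOn j).mono hj.1), hcard]
    obtain ⟨i, hi, e⟩ := (D j).H1_exhaust _ hj.2.1 hc fun h => htree ⟨hcard, j, hj, h⟩
    obtain ⟨S₂, hS₂, e₂⟩ := P.exists_lift ((D j).H2_mem i hi).1
    refine ⟨j, i, S₂, hj, isHome_of_notMem_face hS₂ (e₂ ▸ ((D j).H2_mem i hi).1) ?_, hi, e, e₂⟩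
    -- The triangle is not in the face, since its edge is not; hence it has the same home as the
    -- edge.
    by_cases hr : j = P.root
    · exact Or.inl hr
    · refine Or.inr fun hf => hj.notMem_face hr (((P.face j).isRelLowerSet_faces hf).2 ?_ ?_)
      · rw [e₂, ← e]
        exact (D j).H1_subset_H2 hi
      · rw [← Finset.card_pos, hc]
        norm_num
  choose j i φ hj hφ hi e e₂ using key
  have hcard : ∀ x, (φ x).card = 3 := fun x => by
    rw [← Finset.card_image_of_injOn ((P.injOn _).mono (hφ x).1), e₂,
      ((D _).H2_mem _ (hi x)).2]
  have hsub : ∀ x, x.1 ⊆ φ x := by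
    intro x y hy
    have h1 : P.F y ∈ (φ x).image P.F := by
      rw [e₂]
      exact (D _).H1_subset_H2 (hi x) (e x ▸ Finset.mem_image_of_mem _ hy)
    obtain ⟨y', hy', h⟩ := Finset.mem_image.1 h1
    rwa [← P.injOn (j x) ((hφ x).1 hy') ((hj x).1 hy) h]
  have hlt : ∀ x x', x' ≠ x → x'.1 ⊆ φ x →
      toLex (P.ht (j x'), i x') < toLex (P.ht (j x), i x) := fun x x' hne hs =>
    (hj x).lt_of_subset (hi x) (hi x') (hj x') (hφ x) (e x) (e x') (e₂ x)
      (fun h => hne (Subtype.ext h)) hs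
  -- Lexicographic pairs cannot serve as indices in `ℕ`, since an edge may have infinitely many
  -- predecessors. Only the edges of the paired triangle need to precede it, and they are finite in
  -- number.
  obtain ⟨rank, hrank, hrank'⟩ := exists_injective_rank (fun x' x => x' ≠ x ∧ x'.1 ⊆ φ x)
    (Subrelation.wf (fun {x' x} h => hlt x x' h.1 h.2)
      (InvImage.wf (fun x => toLex (P.ht (j x), i x)) (wellFounded_lt (α := ℕ ×ₗ ℕ))))
    (fun x => ((φ x).powerset.finite_toSet.preimage Subtype.val_injective.injOn).subset
      fun x' h => Finset.mem_coe.2 (Finset.mem_powerset.2 h.2))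
  refine ⟨GSCDecomposition.ofRank _ (P.tree D) ?_ (isTree_edgeGraph D hD) φ
    (fun x => ⟨(hφ x).mem_faces, hcard x, hsub x⟩) rank hrank
    fun x x' h1 h2 => hrank' x x' ⟨h1, h2⟩⟩
  rintro S ⟨hc, j, hj, _⟩
  exact ⟨hj.mem_faces, hc⟩

end PieceTree

end PieceTree

/-! ### The pieces of `X` and the tree in which they are glued. -/

section Cover

open Classical

namespace GoodPresentation

variable {V I A : Type*} {P : GoodPresentation V I A} {T : Set A}

theorem PieceVertex.ext_of {v w : P.PieceVertex} (h : v.idx = w.idx) (h' : v.point = w.point) :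
    v = w := by
  cases v
  cases w
  cases h
  cases h'
  rfl

variable (P T) in
/-- The vertex of `X` given by a vertex of a piece in the copy `x Δ`. -/
def pieceMk (x : P.FreeCover T) (v : P.PieceVertex) : P.CoverVertex T :=
  P.coverMk T x (Quot.mk _ v)

variable (P T) in
/-- Crossing the face `g_a` from its source to its target leads from the copy `x Δ` to the copy
`x (crossing a) Δ`. -/
def crossing (a : A) : P.FreeCover T := if h : a ∈ T then 1 else FreeGroup.of ⟨a, h⟩

theorem crossing_of_mem {a : A} (h : a ∈ T) : P.crossing T a = 1 := dif_pos h

theorem crossing_of_notMem {a : A} (h : a ∉ T) : P.crossing T a = FreeGroup.of ⟨a, h⟩ := dif_neg h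

/-- As `crossing` is trivial on `T`, gluings within a copy of `Δ` and between copies take one common
form. -/
theorem pieceMk_eq_pieceMk {a : A} {v w : P.PieceVertex} (hv : v.idx = P.src a)
    (hw : w.idx = P.tgt a) (h : v.point = w.point) (hf : {v.point} ∈ (P.face a).faces)
    (x : P.FreeCover T) : P.pieceMk T x v = P.pieceMk T (x * P.crossing T a) w := by
  by_cases ha : a ∈ T
  · rw [crossing_of_mem ha, mul_one]
    exact congrArg (P.coverMk T x) (Quot.sound ⟨a, ha, hv.symm, hw.symm, h, hf⟩)
  · rw [crossing_of_notMem ha]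
    exact Quot.sound ⟨(⟨a, ha⟩, true), v, w, hv, hw, h, hf, rfl, rfl, rfl⟩

theorem exists_pieceMk (y : P.CoverVertex T) : ∃ x v, y = P.pieceMk T x v := by
  induction y using Quot.ind with
  | mk p =>
    obtain ⟨x, d⟩ := p
    induction d using Quot.ind with
    | mk v => exact ⟨x, v, rfl⟩

/-- Functions on the vertices of the copies of the pieces that are compatible with the gluing
descend to the vertices of `X`. -/
theorem exists_descend {Z : Type*} (c : P.FreeCover T → P.PieceVertex → Z)
    (hc : ∀ a x (v w : P.PieceVertex), v.idx = P.src a → w.idx = P.tgt a → v.point = w.point →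
      {v.point} ∈ (P.face a).faces → c x v = c (x * P.crossing T a) w) :
    ∃ f : P.CoverVertex T → Z, ∀ x v, f (P.pieceMk T x v) = c x v := by
  have h1 : ∀ x v w, P.DomainRel T v w → c x v = c x w := by
    rintro x v w ⟨a, ha, hv, hw, h, hf⟩
    rw [hc a x v w hv.symm hw.symm h hf, crossing_of_mem ha, mul_one]
  refine ⟨Quot.lift (fun p => Quot.lift (c p.1) (h1 p.1) p.2) ?_, fun x v => rfl⟩
  rintro ⟨x, d⟩ ⟨x', d'⟩ ⟨⟨⟨a, ha⟩, b⟩, v, w, hv, hw, h, hf, rfl, rfl, rfl⟩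
  cases b
  -- For the free face on the target side the gluing is read backwards, starting from the
  -- neighbouring copy.
  · have := hc a (x * FreeGroup.mk [(⟨a, ha⟩, false)]) w v hw hv h.symm (h ▸ hf)
    rw [crossing_of_notMem ha, mul_assoc, show FreeGroup.mk [(⟨a, ha⟩, false)] *
      FreeGroup.of (⟨a, ha⟩ : {a // a ∉ T}) = 1 from inv_mul_cancel (FreeGroup.of _), mul_one] at this
    exact this.symm
  · have := hc a x v w hv hw h hf
    rw [crossing_of_notMem ha] at this
    exact this

theorem mem_cover_faces {S : Finset (P.CoverVertex T)} : S ∈ (P.cover T).faces ↔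
    ∃ x i, ∃ τ : Finset P.PieceVertex, (∀ v ∈ τ, v.idx = i) ∧
      τ.image PieceVertex.point ∈ (P.piece i).faces ∧ S = τ.image (P.pieceMk T x) := by
  constructor
  · rintro ⟨x, _, ⟨i, τ, h1, h2, rfl⟩, rfl⟩
    exact ⟨x, i, τ, h1, h2, Finset.image_image⟩
  · rintro ⟨x, i, τ, h1, h2, rfl⟩
    exact ⟨x, _, ⟨i, τ, h1, h2, rfl⟩, Finset.image_image.symm⟩

variable (P T) in
/-- The pieces `j = (x, i)` and `k` of `X` are glued along the face `g_a`. -/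
def Abuts (a : A) (j k : P.FreeCover T × I) : Prop :=
  j.2 = P.src a ∧ k.2 = P.tgt a ∧ k.1 = j.1 * P.crossing T a

/-- Outside `T` the generator determines the face; inside `T`, where the crossing is 1, the pair of
pieces does. -/
theorem crossing_injective_of (hT : P.IsArborescent T) {a a' : A}
    (h : P.crossing T a = P.crossing T a')
    (he : s(P.src a, P.tgt a) = s(P.src a', P.tgt a')) : a = a' := by
  by_cases ha : a ∈ T <;> by_cases ha' : a' ∈ T
  · exact hT.2 ha ha' he
  · rw [crossing_of_mem ha, crossing_of_notMem ha'] at h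
    exact absurd h.symm (FreeGroup.of_ne_one _)
  · rw [crossing_of_mem ha', crossing_of_notMem ha] at h
    exact absurd h (FreeGroup.of_ne_one _)
  · rw [crossing_of_notMem ha, crossing_of_notMem ha'] at h
    exact congrArg Subtype.val (FreeGroup.of_injective h)

theorem Abuts.unique (hT : P.IsArborescent T) {a a' : A} {j k : P.FreeCover T × I}
    (h : P.Abuts T a j k) (h' : P.Abuts T a' j k) : a = a' :=
  crossing_injective_of hT (mul_left_cancel (h.2.2.symm.trans h'.2.2))
    (by rw [← h.1, ← h.2.1, ← h'.1, ← h'.2.1])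

/-- A crossing has exponent sum 0 or 1, with 0 only for faces in `T`. Two crossings with product 1
are thus both trivial. -/
theorem Abuts.unique_symm (hT : P.IsArborescent T) {a a' : A} {j k : P.FreeCover T × I}
    (h : P.Abuts T a j k) (h' : P.Abuts T a' k j) : a = a' := by
  have h1 : P.crossing T a * P.crossing T a' = 1 := by
    have := h'.2.2
    rw [h.2.2, mul_assoc] at this
    exact mul_eq_left.1 this.symm
  let deg : P.FreeCover T →* Multiplicative ℤ := FreeGroup.lift fun _ => Multiplicative.ofAdd 1
  have hdeg : ∀ a, 0 ≤ (deg (P.crossing T a)).toAdd ∧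
      ((deg (P.crossing T a)).toAdd = 0 → P.crossing T a = 1) := by
    intro a
    by_cases ha : a ∈ T
    · rw [crossing_of_mem ha]
      simp
    · rw [crossing_of_notMem ha]
      simp [deg]
  have h2 : (deg (P.crossing T a)).toAdd + (deg (P.crossing T a')).toAdd = 0 := by
    rw [← toAdd_mul, ← map_mul, h1, map_one, toAdd_one]
  have h3 := hdeg a
  have h4 := hdeg a'
  refine crossing_injective_of hT ?_ ?_
  · rw [h3.2 (by omega), h4.2 (by omega)]
  · rw [← h.1, ← h.2.1, ← h'.1, ← h'.2.1, Sym2.eq_swap]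

/-- The pieces of `X` are glued in the pattern of a tree. -/
theorem exists_root_par [Finite I] (hT : P.IsArborescent T) :
    ∃ (root : P.FreeCover T × I) (par : P.FreeCover T × I → P.FreeCover T × I)
      (ht : P.FreeCover T × I → ℕ),
      (∀ j, j ≠ root → ht (par j) < ht j ∧ ∃ a, P.Abuts T a j (par j) ∨ P.Abuts T a (par j) j) ∧
      ∀ a j k, P.Abuts T a j k → (j ≠ root ∧ par j = k) ∨ (k ≠ root ∧ par k = j) := by
  obtain ⟨i₀⟩ := hT.1.connected.nonempty
  choose parI hI h1 h2 _ using fun r => hT.1.exists_parent r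
  obtain ⟨B, hB⟩ : ∃ B, ∀ r i, hI r i < B := by
    obtain ⟨B, hB⟩ := (Set.finite_range fun p : I × I => hI p.1 p.2).bddAbove
    exact ⟨B + 1, fun r i => Nat.lt_succ_of_le (hB ⟨(r, i), rfl⟩)⟩
  let side : A → Bool → I := fun a b => if b then P.src a else P.tgt a
  -- The first letter of `x⁻¹` is the free face of `x Δ` leading to the neighbouring copy of shorter
  -- word length. The piece containing it is taken as the root `rt x` of the tree of pieces in `x
  -- Δ`.
  have hnext : ∀ x : P.FreeCover T, ∃ (rt : I) (next : P.FreeCover T × I),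
      (x = 1 ∧ rt = i₀) ∨ ∃ a b L, x⁻¹.toWord = (a, b) :: L ∧ rt = side a.1 b ∧
        next = (x * FreeGroup.mk [(a, b)], side a.1 !b) := by
    intro x
    rcases hx : x⁻¹.toWord with _ | ⟨⟨a, b⟩, L⟩
    · exact ⟨i₀, (x, i₀), Or.inl ⟨inv_eq_one.1 (FreeGroup.toWord_eq_nil_iff.1 hx), rfl⟩⟩
    · exact ⟨_, _, Or.inr ⟨a, b, L, rfl, rfl, rfl⟩⟩
  choose rt next hnext using hnext
  have hrt1 : rt 1 = i₀ := by
    rcases hnext 1 with h | ⟨a, b, L, h, _⟩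
    · exact h.2
    · simp at h
  have hword : ∀ x a b L, x⁻¹.toWord = (a, b) :: L →
      rt x = side a.1 b ∧ next x = (x * FreeGroup.mk [(a, b)], side a.1 !b) := by
    intro x a b L h
    rcases hnext x with ⟨rfl, _⟩ | ⟨a', b', L', h', h1, h2⟩
    · simp at h
    · obtain ⟨h3, rfl⟩ := List.cons.inj (h.symm.trans h')
      obtain ⟨rfl, rfl⟩ := Prod.ext_iff.1 h3
      exact ⟨h1, h2⟩
  have hlen : ∀ (x : P.FreeCover T) a b L, x⁻¹.toWord = (a, b) :: L →
      (x * FreeGroup.mk [(a, b)])⁻¹.toWord = L := by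
    intro x a b L h
    have hx : x⁻¹ = FreeGroup.mk [(a, b)] * FreeGroup.mk L := by
      rw [FreeGroup.mul_mk, List.singleton_append, ← h, FreeGroup.mk_toWord]
    have hr : FreeGroup.IsReduced L := by
      have := FreeGroup.isReduced_toWord (x := x⁻¹)
      rw [h] at this
      exact this.infix ⟨[(a, b)], [], by simp⟩
    rw [mul_inv_rev, hx, inv_mul_cancel_left, FreeGroup.toWord_mk, hr.reduce_eq]
  let par : P.FreeCover T × I → P.FreeCover T × I := fun j =>
    if j.2 = rt j.1 then next j.1 else (j.1, parI (rt j.1) j.2)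
  have hroot : ∀ x a b L, x⁻¹.toWord = (a, b) :: L → ∀ i i', (x, i) ≠ ((1, i') : P.FreeCover T × I) := by
    intro x a b L h i i' h'
    have hx : x = 1 := (Prod.ext_iff.1 h').1
    subst hx
    simp at h
  -- As `B` exceeds every height within a copy, word length dominates and passing to the shorter
  -- copy lowers the total height.
  refine ⟨(1, i₀), par, fun j => j.1⁻¹.toWord.length * B + hI (rt j.1) j.2, ?_, ?_⟩
  · rintro ⟨x, i⟩ hj
    by_cases hi : i = rt x
    · have hpar : par (x, i) = next x := if_pos hi
      rcases hnext x with ⟨rfl, h⟩ | ⟨a, b, L, h, h', h''⟩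
      · exact absurd (by rw [hi, h]) hj
      · rw [hpar, h'']
        refine ⟨?_, a.1, ?_⟩
        · dsimp only
          rw [hlen x a b L h, h, List.length_cons, Nat.succ_mul]
          have := hB (rt (x * FreeGroup.mk [(a, b)])) (side a.1 !b)
          omega
        · subst hi
          cases b
          · refine Or.inr ⟨rfl, h', ?_⟩
            rw [crossing_of_notMem a.2, mul_assoc, show FreeGroup.mk [(a, false)] *
              FreeGroup.of a = 1 from inv_mul_cancel (FreeGroup.of _), mul_one]
          · exact Or.inl ⟨h', rfl, by rw [crossing_of_notMem a.2]; rfl⟩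
    · have hpar : par (x, i) = (x, parI (rt x) i) := if_neg hi
      obtain ⟨hadj, hlt⟩ := h1 (rt x) i hi
      rw [hpar]
      refine ⟨by dsimp only; omega, ?_⟩
      obtain ⟨_, ⟨a, ha, h⟩ | ⟨a, ha, h⟩⟩ := (SimpleGraph.fromRel_adj _ _ _).1 hadj
      · exact ⟨a, Or.inl ⟨h.1.symm, h.2.symm, by rw [crossing_of_mem ha, mul_one]⟩⟩
      · exact ⟨a, Or.inr ⟨h.1.symm, h.2.symm, by rw [crossing_of_mem ha, mul_one]⟩⟩
  · rintro a ⟨x, i⟩ ⟨x', i'⟩ ⟨hi, hi', hx⟩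
    dsimp only at hi hi' hx
    subst hi hi'
    by_cases ha : a ∈ T
    · rw [crossing_of_mem ha, mul_one] at hx
      subst hx
      have hroot' : ∀ i, i ≠ rt x' → (x', i) ≠ ((1, i₀) : P.FreeCover T × I) := by
        intro i hi h
        have e₁ : x' = 1 := (Prod.ext_iff.1 h).1
        have e₂ : i = i₀ := (Prod.ext_iff.1 h).2
        exact hi (by rw [e₁, e₂, hrt1])
      rcases h2 (rt x') (P.src a) (P.tgt a) ((SimpleGraph.fromRel_adj _ _ _).2
        ⟨P.src_ne_tgt a, Or.inl ⟨a, ha, rfl, rfl⟩⟩) with h | h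
      · refine Or.inl ⟨hroot' _ h.1, ?_⟩
        rw [← h.2]
        exact if_neg h.1
      · refine Or.inr ⟨hroot' _ h.1, ?_⟩
        rw [← h.2]
        exact if_neg h.1
    · rw [crossing_of_notMem ha] at hx
      have hfin : ∀ (y : P.FreeCover T) b L, y⁻¹.toWord = (⟨a, ha⟩, b) :: L →
          (y, side a b) ≠ ((1, i₀) : P.FreeCover T × I) ∧
          par (y, side a b) = (y * FreeGroup.mk [(⟨a, ha⟩, b)], side a !b) := by
        intro y b L h
        obtain ⟨h3, h4⟩ := hword y _ b L h
        exact ⟨hroot y _ b L h _ _, (if_pos h3.symm).trans h4⟩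
      -- Either `x⁻¹` begins with the letter of `a` and the crossing shortens `x`, or `(x a)⁻¹` is
      -- the reduced word of `x⁻¹` preceded by the inverse letter, and the way back from `x a` is
      -- the shortening.
      by_cases hL : ∃ L, x⁻¹.toWord = (⟨a, ha⟩, true) :: L
      · obtain ⟨L, hL⟩ := hL
        obtain ⟨h3, h4⟩ := hfin x true L hL
        exact Or.inl ⟨h3, h4.trans (by rw [hx]; rfl)⟩
      · have hw : x'⁻¹.toWord = (⟨a, ha⟩, false) :: x⁻¹.toWord := by
          have : x'⁻¹ = FreeGroup.mk ((⟨a, ha⟩, false) :: x⁻¹.toWord) := by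
            rw [hx, mul_inv_rev, ← List.singleton_append, ← FreeGroup.mul_mk, FreeGroup.mk_toWord]
            rfl
          rw [this, FreeGroup.toWord_mk, FreeGroup.reduce.cons, FreeGroup.reduce_toWord]
          rcases hL' : x⁻¹.toWord with _ | ⟨⟨a', b'⟩, L⟩
          · rfl
          · refine if_neg fun h => hL ⟨L, ?_⟩
            obtain ⟨rfl, h5⟩ := h
            rw [hL']
            cases b' <;> simp_all
        obtain ⟨h3, h4⟩ := hfin x' false _ hw
        refine Or.inr ⟨h3, h4.trans ?_⟩
        rw [hx, mul_assoc, show FreeGroup.of (⟨a, ha⟩ : {a // a ∉ T}) *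
          FreeGroup.mk [(⟨a, ha⟩, false)] = 1 from mul_inv_cancel (FreeGroup.of _), mul_one]
        rfl

end GoodPresentation

end Cover

/-! ### Geometric simple connectivity of `X`. -/

section CoverGSC

open Classical

namespace GoodPresentation

variable {V I A : Type*} {P : GoodPresentation V I A} {T : Set A}

/-- The structure of a tree of pieces on `X`. -/
theorem exists_pieceTree [Finite I] (hT : P.IsArborescent T) :
    ∃ Q : PieceTree V (P.FreeCover T × I) (P.CoverVertex T),
      Q.X = P.cover T ∧ (∀ j, Q.piece j = P.piece j.2) ∧
      ∀ j, j ≠ Q.root → ∃ a, Q.face j = P.face a ∧ (j.2 = P.src a ∨ j.2 = P.tgt a) := by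
  obtain ⟨root, par, ht, hpar, habut⟩ := P.exists_root_par hT
  choose lab hlab using fun j (hj : j ≠ root) => (hpar j hj).2
  let face : P.FreeCover T × I → PreAbstractSimplicialComplex V := fun j =>
    if h : j ≠ root then P.face (lab j h) else P.piece j.2
  have hface : ∀ j (h : j ≠ root), face j = P.face (lab j h) := fun j h => dif_pos h
  have hle : ∀ j, j ≠ root → face j ≤ P.piece j.2 ∧ face j ≤ P.piece (par j).2 := by
    intro j hj
    rw [hface j hj]
    rcases hlab j hj with h | h
    · rw [h.1, h.2.1]
      exact ⟨P.face_le_src _, P.face_le_tgt _⟩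
    · rw [h.1, h.2.1]
      exact ⟨P.face_le_tgt _, P.face_le_src _⟩
  let glued : P.FreeCover T × I → V → Prop := fun j v => j ≠ root ∧ {v} ∈ (face j).faces
  -- `H j v` climbs from `j` to parents as long as `v` lies in the face towards the parent; it ends
  -- at the first piece containing the vertex.
  obtain ⟨H, hH⟩ : ∃ H : P.FreeCover T × I → V → P.FreeCover T × I, ∀ j v,
      H j v = if glued j v then H (par j) v else j := by
    let step : ∀ j, (∀ k, ht k < ht j → V → P.FreeCover T × I) → V → P.FreeCover T × I :=
      fun j ih v => if h : glued j v then ih (par j) (hpar j h.1).1 v else j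
    have wf := InvImage.wf ht (wellFounded_lt (α := ℕ))
    refine ⟨wf.fix step, fun j v => ?_⟩
    rw [← dite_eq_ite]
    exact congrFun (wf.fix_eq step j) v
  have hglue : ∀ j (v : P.PieceVertex), v.idx = j.2 → glued j v.point →
      ∃ w : P.PieceVertex, w.idx = (par j).2 ∧ w.point = v.point ∧
        P.pieceMk T j.1 v = P.pieceMk T (par j).1 w := by
    intro j v hv hg
    refine ⟨⟨(par j).2, v.point, (hle j hg.1).2 hg.2⟩, rfl, rfl, ?_⟩
    have hf := hg.2
    rw [hface j hg.1] at hf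
    rcases hlab j hg.1 with h | h
    · rw [h.2.2]
      exact pieceMk_eq_pieceMk (w := ⟨(par j).2, v.point, (hle j hg.1).2 hg.2⟩)
        (hv.trans h.1) h.2.1 rfl hf _
    · have := pieceMk_eq_pieceMk (v := ⟨(par j).2, v.point, (hle j hg.1).2 hg.2⟩) (w := v)
        h.1 (hv.trans h.2.1) rfl hf (par j).1
      rw [this, h.2.2]
  -- Abutting pieces are child and parent, and the face between them is unique. A vertex on it
  -- therefore climbs from the child to the parent, and both climbs agree.
  obtain ⟨home, hhome⟩ := P.exists_descend (T := T) (fun x v => H (x, v.idx) v.point) (by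
    intro a x v w hv hw h hf
    have hab : P.Abuts T a (x, v.idx) (x * P.crossing T a, w.idx) := ⟨hv, hw, rfl⟩
    rcases habut a _ _ hab with ⟨h1, h2⟩ | ⟨h1, h2⟩
    · have hl : lab _ h1 = a := by
        rcases hlab _ h1 with h' | h'
        · exact h'.unique hT (h2 ▸ hab)
        · exact h'.unique_symm hT (h2 ▸ hab)
      rw [hH, if_pos ⟨h1, by rw [hface _ h1, hl]; exact hf⟩, h2, h]
    · have hl : lab _ h1 = a := by
        rcases hlab _ h1 with h' | h'
        · exact h'.unique_symm hT (h2 ▸ hab)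
        · exact h'.unique hT (h2 ▸ hab)
      rw [hH (x * P.crossing T a, w.idx), if_pos ⟨h1, by rw [hface _ h1, hl, ← h]; exact hf⟩, h2, h])
  let mem : P.FreeCover T × I → Set (P.CoverVertex T) := fun j =>
    (P.pieceMk T j.1) '' {v | v.idx = j.2}
  have hmem : ∀ j (v : P.PieceVertex), v.idx = j.2 →
      P.pieceMk T j.1 v ∈ mem (H j v.point) ∧
        (H j v.point = root ∨ {v.point} ∉ (face (H j v.point)).faces) := by
    intro j
    induction hn : ht j using Nat.strong_induction_on generalizing j with
    | _ n ih =>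
      subst hn
      intro v hv
      by_cases hg : glued j v.point
      · obtain ⟨w, hw, hwv, e⟩ := hglue j v hv hg
        rw [hH, if_pos hg, e, ← hwv]
        exact ih _ (hpar j hg.1).1 (par j) rfl w hw
      · rw [hH, if_neg hg]
        exact ⟨⟨v, hv, rfl⟩, by_contra fun h => hg (not_or.1 h |>.imp id not_not.1)⟩
  refine ⟨{
    X := P.cover T
    F := P.taut T
    root := root
    par := par
    ht := ht
    piece := fun j => P.piece j.2
    face := face
    mem := mem
    home := home
    ht_par := fun j hj => (hpar j hj).1
    face_le := fun j hj => (hle j hj).1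
    face_le_par := fun j hj => (hle j hj).2
    full := ?_
    injOn := ?_
    surj := fun j v hv => ⟨_, ⟨⟨j.2, v, hv⟩, rfl, rfl⟩, rfl⟩
    mem_piece := ?_
    faces_iff := ?_
    mem_home := ?_
    home_cases := ?_
    home_root := ?_ }, rfl, fun j => rfl, ?_⟩
  · intro j hj σ hσ h
    rw [hface j hj] at h ⊢
    rcases hlab j hj with h' | h'
    · exact P.full_src _ σ (h'.1 ▸ hσ) h
    · exact P.full_tgt _ σ (h'.2.1 ▸ hσ) h
  · rintro j _ ⟨v, hv, rfl⟩ _ ⟨w, hw, rfl⟩ h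
    rw [PieceVertex.ext_of (Eq.trans hv (Eq.symm hw)) h]
  · rintro j _ ⟨v, hv, rfl⟩
    have := v.mem
    rw [show v.idx = j.2 from hv] at this
    exact this
  · intro S
    rw [mem_cover_faces]
    constructor
    · rintro ⟨x, i, τ, h1, h2, rfl⟩
      refine ⟨(x, i), ?_, ?_⟩
      · rw [Finset.coe_image]
        exact Set.image_mono h1
      · rw [Finset.image_image]
        exact h2
    · rintro ⟨j, h1, h2⟩
      obtain ⟨τ, hτ, rfl⟩ := Finset.subset_set_image_iff.1 h1
      rw [Finset.image_image] at h2
      exact ⟨j.1, j.2, τ, hτ, h2, rfl⟩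
  · intro y
    obtain ⟨x, v, rfl⟩ := exists_pieceMk y
    rw [hhome]
    exact (hmem (x, v.idx) v rfl).1
  · rintro j _ ⟨v, hv, rfl⟩
    have hj : j = (j.1, v.idx) := Prod.ext rfl (Eq.symm hv)
    rw [hhome, ← hj, hH]
    by_cases hg : glued j v.point
    · obtain ⟨w, hw, _, e⟩ := hglue j v hv hg
      exact Or.inr ⟨hg.1, hg.2, w, hw, e.symm⟩
    · exact Or.inl (if_neg hg).symm
  · intro y
    obtain ⟨x, v, rfl⟩ := exists_pieceMk y
    rw [hhome]
    exact (hmem (x, v.idx) v rfl).2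
  · intro j hj
    refine ⟨lab j hj, hface j hj, (hlab j hj).imp (fun h => h.1) fun h => h.2.1⟩

theorem countable_coverVertex [Finite V] [Finite I] [Finite A] : Countable (P.CoverVertex T) := by
  have : Countable (P.FreeCover T) := FreeGroup.toWord_injective.countable
  have : Countable P.PieceVertex := by
    refine Function.Injective.countable (f := fun v : P.PieceVertex => (v.idx, v.point)) ?_
    intro v w h
    exact PieceVertex.ext_of (Prod.ext_iff.1 h).1 (Prod.ext_iff.1 h).2
  have h : Function.Surjective fun p : P.FreeCover T × P.PieceVertex => P.pieceMk T p.1 p.2 := by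
    intro y
    obtain ⟨x, v, rfl⟩ := exists_pieceMk y
    exact ⟨(x, v), rfl⟩
  exact h.countable

/-- For each copy of a piece a decomposition adapted to the face towards its parent is chosen, so no
single one has to suit all the faces of a piece. -/
theorem isGSC_cover [Finite V] [Finite I] [Finite A] (hT : P.IsArborescent T) :
    IsGSC (P.cover T).toPreAbstractSimplicialComplex := by
  obtain ⟨Q, hX, hpiece, hface⟩ := P.exists_pieceTree hT
  have := P.countable_coverVertex (T := T)
  have hD : ∀ j, ∃ D : GSCDecomposition (Q.piece j), j ≠ Q.root →
      (edgeGraph (Q.face j) {e | e ∈ D.tree ∧ e ∈ (Q.face j).faces}).IsTree := by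
    intro j
    by_cases hj : j = Q.root
    · rw [hpiece]
      exact ⟨(P.gsc_piece j.2).some, fun h => absurd hj h⟩
    · obtain ⟨a, ha, h | h⟩ := hface j hj
      · obtain ⟨D, hD⟩ := P.gsc_src a
        rw [ha, hpiece, h]
        exact ⟨D, fun _ => hD.1⟩
      · obtain ⟨D, hD⟩ := P.gsc_tgt a
        rw [ha, hpiece, h]
        exact ⟨D, fun _ => hD.1⟩
  choose D hD using hD
  rw [← hX]
  exact Q.isGSC D hD

end GoodPresentation

end CoverGSC

/-! ### Unique lifting and the deck action. -/

section Deck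

open Classical Realization

/-- Paths with the same ends in a simply connected space are homotopic, and the homotopy projects.
-/
theorem loopClass_eq_of_liftsTo {S E : Type*} [TopologicalSpace S] [TopologicalSpace E]
    [SimplyConnectedSpace E] {φ : E → S} (hφ : Continuous φ) {b : S} {γ γ' : Path b b} {x y : E}
    (h : LiftsTo φ γ x y) (h' : LiftsTo φ γ' x y) : loopClass γ = loopClass γ' := by
  obtain ⟨δ, hδ⟩ := h
  obtain ⟨δ', hδ'⟩ := h'
  have hx : b = φ x := by simpa using (hδ 0).symm
  have hy : b = φ y := by simpa using (hδ 1).symm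
  have e : γ = (δ.map hφ).cast hx hy := by ext t; exact (hδ t).symm
  have e' : γ' = (δ'.map hφ).cast hx hy := by ext t; exact (hδ' t).symm
  have hh : Path.Homotopic (δ.map hφ) (δ'.map hφ) :=
    (SimplyConnectedSpace.paths_homotopic δ δ').map ⟨φ, hφ⟩
  have hh' : Path.Homotopic γ γ' := by rw [e, e']; exact hh
  rw [loopClass, loopClass, Path.Homotopic.Quotient.eq.2 hh']

theorem exists_loopClass_eq {S : Type*} [TopologicalSpace S] {x : S} (g : PiOne S x) :
    ∃ γ : Path x x, loopClass γ = g := by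
  obtain ⟨γ, hγ⟩ := Path.Homotopic.Quotient.mk_surjective (FundamentalGroup.toPath g.unop)
  exact ⟨γ, MulOpposite.unop_injective hγ⟩

theorem loopClass_refl {S : Type*} [TopologicalSpace S] (x : S) :
    loopClass (Path.refl x) = 1 := rfl

variable {U V W G : Type*} {N : AbstractSimplicialComplex W} {M : AbstractSimplicialComplex V}

theorem IsGSC.pathConnectedSpace {K : AbstractSimplicialComplex U}
    (h : IsGSC K.toPreAbstractSimplicialComplex) : PathConnectedSpace (Realization K) := by
  obtain ⟨D⟩ := h
  obtain ⟨v₀⟩ := D.isTree.connected.nonempty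
  refine pathConnectedSpace_of_joined v₀.1 fun v => ?_
  obtain ⟨w⟩ := D.isTree.connected.preconnected v₀ ⟨v, K.singleton_mem v⟩
  suffices h : ∀ u v : {v // {v} ∈ K.faces}, (edgeGraph K.toPreAbstractSimplicialComplex D.tree).Walk u v →
    Joined (vert K u.1) (vert K v.1) from h _ _ w
  intro u v w
  induction w with
  | nil => exact Joined.refl _
  | cons hadj _ ih =>
    exact (joined_of_carrier_subset (D.tree_mem _ hadj.2).1 (by simp) (by simp)).trans ih

namespace SimplicialMap

theorem real_eq_real {K : AbstractSimplicialComplex U} {U' : Type*}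
    {L : AbstractSimplicialComplex U'} (f : SimplicialMap K M) (g : SimplicialMap M N)
    (f' : SimplicialMap K L) (g' : SimplicialMap L N) (h : ∀ v, g (f v) = g' (f' v))
    (x : Realization K) : g.real (f.real x) = g'.real (f'.real x) := by
  ext1
  change Finsupp.mapDomain g (Finsupp.mapDomain f x.weight) =
    Finsupp.mapDomain g' (Finsupp.mapDomain f' x.weight)
  rw [← Finsupp.mapDomain_comp, ← Finsupp.mapDomain_comp]
  exact Finsupp.mapDomain_congr fun v _ => h v

theorem IsStarBijective.eq_of_adjacent {p : SimplicialMap N M} (hp : p.IsStarBijective)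
    {w u u' : W} (h : {w, u} ∈ N.faces) (h' : {w, u'} ∈ N.faces) (hu : p u = p u') : u = u' := by
  have e := hp.lift_unique w _ h _ h' (by simp) (by simp)
    (by rw [Finset.image_insert, Finset.image_insert, Finset.image_singleton,
      Finset.image_singleton, hu])
  have hu'' : u ∈ ({w, u'} : Finset W) := e ▸ by simp
  exact hp.nonDegenerate _ h' hu'' (by simp) hu

/-- Lifts of a map of a connected complex through a combinatorial covering are determined by
the image of one vertex. -/
theorem IsStarBijective.eq_of_lift {p : SimplicialMap N M} (hp : p.IsStarBijective)
    {K : AbstractSimplicialComplex U} [PreconnectedSpace (Realization K)]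
    {f f' : SimplicialMap K N} (h : ∀ v, p (f v) = p (f' v)) {v₀ : U} (h₀ : f v₀ = f' v₀) :
    f = f' := by
  ext v
  refine vertex_induction (K := K) (C := {v | f v = f' v}) h₀ ?_ v
  intro σ hσ v hv w hw e
  have hvw : {v, w} ∈ K.faces := (K.isRelLowerSet_faces hσ).2
    (by intro u hu; rcases Finset.mem_insert.1 hu with rfl | hu
        · exact hv
        · exact Finset.mem_singleton.1 hu ▸ hw) (by simp)
  have h1 := f.map_faces _ hvw
  have h2 := f'.map_faces _ hvw
  rw [Finset.image_insert, Finset.image_singleton] at h1 h2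
  rw [Set.mem_ofPred_eq] at e ⊢
  rw [e] at h1
  exact hp.eq_of_adjacent h1 h2 (h w)

end SimplicialMap

variable [Group G] [MulAction G W] {p : SimplicialMap N M} {b : Realization M}
  {e : G ≃* PiOne (Realization M) b} {y : Realization N}

/-- For a vertex carrying the base point, a path to the corresponding point over `b` projects to a
loop whose class is the required element. Unique lifting of simplices carries transitivity on fibres
to the other vertices. -/
theorem IsNaturalAction.exists_smul_eq (hG : IsNaturalAction p e y) (hp : IsUniversalCovering p)
    (hy : p.real y = b) {w w' : W} (h : p w = p w') : ∃ g : G, g • w = w' := by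
  have := hp.simplyConnected
  have hs := SimplicialMap.isStarBijective_of_isCoveringMap hp.covering
  obtain ⟨w₀, hw₀⟩ := y.carrier_nonempty
  refine vertex_induction (K := N) (C := {w | ∀ w', p w = p w' → ∃ g : G, g • w = w'})
    (v₀ := w₀) ?_ ?_ w w' h
  · intro w' h
    have hb : b.carrier = y.carrier.image p := by rw [← hy, p.carrier_real]
    obtain ⟨τ, hτ, hw', e₁⟩ := hs.exists_lift w' _ b.support_mem
      (by rw [← carrier, hb, ← h]; exact Finset.mem_image_of_mem _ hw₀)
    obtain ⟨z, hz, hzb⟩ := p.exists_real_eq hτ e₁.symm.subset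
    obtain ⟨δ⟩ := PathConnectedSpace.joined y z
    let γ : Path b b := (δ.map p.continuous_real).cast hy.symm hzb.symm
    obtain ⟨δ', hδ'⟩ := hG.monodromy (e.symm (loopClass γ)) γ (e.apply_symm_apply _).symm
    have hzy := hp.covering.path_target_eq δ δ' rfl fun t => (hδ' t).symm
    have hwz : w' ∈ z.carrier := by
      have h1 : p w' ∈ z.carrier.image p := by
        rw [← p.carrier_real, hzb, hb, ← h]; exact Finset.mem_image_of_mem _ hw₀
      obtain ⟨u, hu, huw⟩ := Finset.mem_image.1 h1
      rwa [← hs.nonDegenerate τ hτ (hz hu) hw' huw]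
    rw [hzy, SimplicialMap.carrier_real] at hwz
    obtain ⟨u, hu, huw⟩ := Finset.mem_image.1 hwz
    refine ⟨e.symm (loopClass γ), ?_⟩
    have huw' : e.symm (loopClass γ) • u = w' := huw
    rwa [← hs.nonDegenerate _ y.support_mem hu hw₀ (by rw [h, ← huw', hG.deck])]
  · intro σ hσ v hv w hw hC w' h
    obtain ⟨τ, hτ, hw', e₁⟩ := hs.exists_lift w' _ (p.map_faces σ hσ)
      (h ▸ Finset.mem_image_of_mem _ hw)
    obtain ⟨v', hv', hvv⟩ := Finset.mem_image.1 (e₁.symm ▸ Finset.mem_image_of_mem p hv)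
    obtain ⟨g, rfl⟩ := hC v' hvv.symm
    refine ⟨g, ?_⟩
    have e₂ : σ.image (fun w => g • w) = τ := by
      refine hs.lift_unique (g • v) _ (hG.simplicial g σ hσ) τ hτ (Finset.mem_image_of_mem _ hv)
        hv' ?_
      rw [e₁, Finset.image_image]
      exact Finset.image_congr fun u _ => hG.deck g u
    have hgw : g • w ∈ τ := e₂ ▸ Finset.mem_image_of_mem _ hw
    exact hs.nonDegenerate τ hτ hgw hw' ((hG.deck g w).trans h)

/-- Fixing a vertex of the carrier of `y` forces the element to fix `y`, so its loop lifts to a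
closed path and is null-homotopic. -/
theorem IsNaturalAction.eq_one_of_smul_eq (hG : IsNaturalAction p e y)
    (hp : IsUniversalCovering p) (hy : p.real y = b) {w : W} (hw : w ∈ y.carrier) {g : G}
    (h : g • w = w) : g = 1 := by
  have := hp.simplyConnected
  have hs := SimplicialMap.isStarBijective_of_isCoveringMap hp.covering
  have hgy : (actionMap hG.simplicial g).real y = y := by
    refine hs.eq_of_carrier (v := w) ?_ hw
      (SimplicialMap.real_eq_of_comp _ _ p (fun v => hG.deck g v) y)
    rw [SimplicialMap.carrier_real]
    exact Finset.mem_image.2 ⟨w, hw, h⟩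
  obtain ⟨γ, hγ⟩ := exists_loopClass_eq (e g)
  have h1 := hG.monodromy g γ hγ
  rw [hgy] at h1
  have h2 : LiftsTo p.real (Path.refl b) y y := ⟨Path.refl y, fun t => hy⟩
  have h3 := loopClass_eq_of_liftsTo hp.covering.continuous h1 h2
  rw [hγ, loopClass_refl] at h3
  exact (map_eq_one_iff e e.injective).1 h3

end Deck

/-! ### The canonical lift and the homomorphism `χ`. -/

section CanonicalLift

open Classical Realization

namespace GoodPresentation

variable {V I A W G : Type*} {P : GoodPresentation V I A} {T : Set A}

theorem exists_pieceVertex_lift {i : I} {σ : Finset V} (hσ : σ ∈ (P.piece i).faces) :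
    ∃ τ : Finset P.PieceVertex, (∀ v ∈ τ, v.idx = i) ∧ τ.image PieceVertex.point = σ := by
  obtain ⟨τ, hτ⟩ := Finset.subset_set_image_iff.1
    (show (σ : Set V) ⊆ PieceVertex.point '' {v : P.PieceVertex | v.idx = i} from fun v hv =>
      ⟨⟨i, v, PreAbstractSimplicialComplex.singleton_mem_of_mem hσ hv⟩, rfl, rfl⟩)
  exact ⟨τ, hτ⟩

theorem taut_nonDegenerate : (P.taut T).NonDegenerate := by
  intro σ hσ
  obtain ⟨x, i, τ, hi, _, rfl⟩ := mem_cover_faces.1 hσ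
  intro a ha b hb h
  obtain ⟨v, hv, rfl⟩ := Finset.mem_image.1 (Finset.mem_coe.1 ha)
  obtain ⟨w, hw, rfl⟩ := Finset.mem_image.1 (Finset.mem_coe.1 hb)
  rw [PieceVertex.ext_of ((hi v hv).trans (hi w hw).symm) h]

theorem isThreeDimensional_cover : IsThreeDimensional (P.cover T) := by
  have hcard : ∀ σ ∈ (P.cover T).faces, (σ.image (P.taut T)).card = σ.card := fun σ hσ =>
    Finset.card_image_of_injOn (taut_nonDegenerate σ hσ)
  refine ⟨fun σ hσ => hcard σ hσ ▸ P.dim.1 _ ((P.taut T).map_faces σ hσ), ?_⟩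
  obtain ⟨σ, hσ, h4⟩ := P.dim.2
  obtain ⟨i, hi⟩ := (P.mem_iff σ).1 hσ
  obtain ⟨τ, hτ, rfl⟩ := P.exists_pieceVertex_lift hi
  have hmem := mem_cover_faces.2 ⟨(1 : P.FreeCover T), i, τ, hτ, hi, rfl⟩
  refine ⟨_, hmem, ?_⟩
  rw [← hcard _ hmem, ← h4, Finset.image_image]
  rfl

/-- A vertex of `X` belongs to a copy of every piece that contains its image in `M`. -/
theorem exists_pieceMk_eq {i : I} (x : P.FreeCover T) (v : P.PieceVertex)
    (hi : {v.point} ∈ (P.piece i).faces) :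
    ∃ x' w, w.idx = i ∧ w.point = v.point ∧ P.pieceMk T x v = P.pieceMk T x' w := by
  have hM : {v.point} ∈ P.M.faces := (P.mem_iff _).2 ⟨i, hi⟩
  let Q : I → I → Prop := fun i j => ∀ x (u : P.PieceVertex), u.idx = i → u.point = v.point →
    ∃ x' w, w.idx = j ∧ w.point = v.point ∧ P.pieceMk T x u = P.pieceMk T x' w
  -- Both directions are carried together so that the induction passes through the symmetry case.
  suffices h : ∀ j, Relation.EqvGen (fun k l => ∃ a, P.src a = k ∧ P.tgt a = l ∧
      {v.point} ∈ (P.face a).faces) j i → Q j i ∧ Q i j from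
    (h _ (P.glue _ hM _ _ v.mem hi)).1 x v rfl rfl
  intro j hj
  clear hi
  induction hj with
  | rel k l h =>
    obtain ⟨a, rfl, rfl, hf⟩ := h
    constructor
    · intro x u hu huv
      exact ⟨_, ⟨P.tgt a, v.point, P.face_le_tgt a hf⟩, rfl, rfl,
        pieceMk_eq_pieceMk (w := ⟨P.tgt a, v.point, P.face_le_tgt a hf⟩) hu rfl huv (huv ▸ hf) x⟩
    · intro x u hu huv
      refine ⟨x * (P.crossing T a)⁻¹, ⟨P.src a, v.point, P.face_le_src a hf⟩, rfl, rfl, ?_⟩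
      have := pieceMk_eq_pieceMk (T := T) (v := ⟨P.src a, v.point, P.face_le_src a hf⟩) (w := u)
        rfl hu huv.symm hf (x * (P.crossing T a)⁻¹)
      rw [this, inv_mul_cancel_right]
  | refl k => exact ⟨fun x u h1 h2 => ⟨x, u, h1, h2, rfl⟩, fun x u h1 h2 => ⟨x, u, h1, h2, rfl⟩⟩
  | symm k l _ ih => exact ih.symm
  | trans k l m _ _ ih₁ ih₂ =>
    have key : ∀ {k l m}, Q k l → Q l m → Q k m := by
      intro k l m h1 h2 x u hu huv
      obtain ⟨x', w, hw, hwv, e⟩ := h1 x u hu huv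
      obtain ⟨x'', w', hw', hwv', e'⟩ := h2 x' w hw hwv
      exact ⟨x'', w', hw', hwv', e.trans e'⟩
    exact ⟨key ih₁.1 ih₂.1, key ih₂.2 ih₁.2⟩

variable {N : AbstractSimplicialComplex W} {p : SimplicialMap N P.M}

/-- Lifts of the tautological map are surjective on the stars of the vertices. -/
theorem exists_lift_of_comp_eq_taut (hp : p.IsStarBijective) {f : SimplicialMap (P.cover T) N}
    (hf : ∀ v, p (f v) = P.taut T v) (v : P.CoverVertex T) (σ : Finset W) (hσ : σ ∈ N.faces)
    (hv : f v ∈ σ) : ∃ τ ∈ (P.cover T).faces, v ∈ τ ∧ τ.image f = σ := by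
  obtain ⟨x, u, rfl⟩ := exists_pieceMk v
  -- The projection of `σ` lies in a piece `i`, and `v` belongs to a copy of that piece. The simplex
  -- over `p(σ)` in this copy goes to `σ` by uniqueness of lifts at `f v`.
  obtain ⟨i, hi⟩ := (P.mem_iff _).1 (p.map_faces σ hσ)
  have hu : u.point ∈ σ.image p := by
    have := Finset.mem_image_of_mem p hv
    rw [hf] at this
    exact this
  obtain ⟨x', w, hw, hwu, e⟩ := P.exists_pieceMk_eq (T := T) x u
    (PreAbstractSimplicialComplex.singleton_mem_of_mem hi hu)
  obtain ⟨τ, hτ, eτ⟩ := P.exists_pieceVertex_lift hi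
  have hmem : τ.image (P.pieceMk T x') ∈ (P.cover T).faces :=
    mem_cover_faces.2 ⟨x', i, τ, hτ, eτ ▸ hi, rfl⟩
  have hwτ : w ∈ τ := by
    rw [← hwu, ← eτ] at hu
    obtain ⟨w', hw', e'⟩ := Finset.mem_image.1 hu
    rwa [← PieceVertex.ext_of ((hτ w' hw').trans hw.symm) e']
  have hvm : P.pieceMk T x u ∈ τ.image (P.pieceMk T x') := e ▸ Finset.mem_image_of_mem _ hwτ
  refine ⟨_, hmem, hvm, ?_⟩
  refine hp.lift_unique _ _ (f.map_faces _ hmem) σ hσ (Finset.mem_image_of_mem _ hvm) hv ?_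
  rw [← eτ, Finset.image_image, Finset.image_image]
  exact Finset.image_congr fun u _ => hf _

variable [Group G] [MulAction G W] {b : Realization P.M}
  {e : G ≃* PiOne (Realization P.M) b} {y : Realization N}

/-- The two lifts of a face that are given by the lifts of the adjacent pieces differ by a deck
transformation. -/
theorem exists_smul_eq_of_face (hp : IsUniversalCovering p) (hG : IsNaturalAction p e y)
    (hy : p.real y = b) {s : SimplicialMap (P.domain T) N} (hs : ∀ d, p (s d) = P.proj T d)
    (a : A) : ∃ g : G, ∀ v w : P.PieceVertex, v.idx = P.src a → w.idx = P.tgt a →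
      v.point = w.point → {v.point} ∈ (P.face a).faces → s (Quot.mk _ v) = g • s (Quot.mk _ w) := by
  have hsb := SimplicialMap.isStarBijective_of_isCoveringMap hp.covering
  obtain ⟨D, hD⟩ := P.gsc_src a
  obtain ⟨u₀⟩ := hD.1.connected.nonempty
  let φ : {v : V // {v} ∈ (P.face a).faces} → W := fun u =>
    s (Quot.mk _ ⟨P.src a, u.1, P.face_le_src a u.2⟩)
  let ψ : {v : V // {v} ∈ (P.face a).faces} → W := fun u =>
    s (Quot.mk _ ⟨P.tgt a, u.1, P.face_le_tgt a u.2⟩)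
  have hφ : ∀ u, p (φ u) = u.1 := fun u => hs _
  have hψ : ∀ u, p (ψ u) = u.1 := fun u => hs _
  -- One vertex of the face fixes the choice of `g`; the equality then travels along the tree of the
  -- face, an edge having a unique lift at a given end.
  obtain ⟨g, hg⟩ := hG.exists_smul_eq hp hy ((hψ u₀).trans (hφ u₀).symm)
  have hpair : ∀ (i : I) (u v : P.PieceVertex), u.idx = i → v.idx = i →
      {u.point, v.point} ∈ (P.piece i).faces →
      ({s (Quot.mk _ u), s (Quot.mk _ v)} : Finset W) ∈ N.faces := by
    intro i u v hu hv h
    have := s.map_faces (({u, v} : Finset P.PieceVertex).image (Quot.mk _))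
      ⟨i, {u, v}, by simp [hu, hv], by simpa [Finset.image_insert] using h, rfl⟩
    simpa only [Finset.image_insert, Finset.image_singleton] using this
  have key : ∀ u v, (edgeGraph (P.face a) {e | e ∈ D.tree ∧ e ∈ (P.face a).faces}).Walk u v →
      φ u = g • ψ u → φ v = g • ψ v := by
    intro u v w
    induction w with
    | nil => exact id
    | cons hadj _ ih =>
      rename_i u₁ u₂ u₃ _
      intro h
      refine ih (hsb.eq_of_adjacent (w := φ u₁) ?_ ?_ ?_)
      · exact hpair (P.src a) _ _ rfl rfl (P.face_le_src a hadj.2.2)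
      · have := hG.simplicial g _ (hpair (P.tgt a) ⟨P.tgt a, u₁.1, P.face_le_tgt a u₁.2⟩
          ⟨P.tgt a, u₂.1, P.face_le_tgt a u₂.2⟩ rfl rfl (P.face_le_tgt a hadj.2.2))
        rw [Finset.image_insert, Finset.image_singleton] at this
        rw [h]
        exact this
      · rw [hφ, hG.deck, hψ]
  refine ⟨g, fun v w hv hw h hf => ?_⟩
  obtain ⟨walk⟩ := hD.1.connected.preconnected u₀ ⟨v.point, hf⟩
  have h1 := key _ _ walk hg.symm
  rwa [show v = ⟨P.src a, v.point, P.face_le_src a hf⟩ from PieceVertex.ext_of hv rfl,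
    show w = ⟨P.tgt a, v.point, P.face_le_tgt a hf⟩ from PieceVertex.ext_of hw h.symm]

/-- The canonical lift, and the homomorphism for which it is equivariant. -/
theorem exists_equivariant_lift (hp : IsUniversalCovering p) (hG : IsNaturalAction p e y)
    (hy : p.real y = b) {s : SimplicialMap (P.domain T) N} (hs : ∀ d, p (s d) = P.proj T d) :
    ∃ (f : SimplicialMap (P.cover T) N) (χ : P.FreeCover T →* G),
      (∀ v, p (f v) = P.taut T v) ∧ ∀ x d, f (P.coverMk T x d) = χ x • s d := by
  choose χ₀ hχ₀ using fun a => P.exists_smul_eq_of_face hp hG hy hs a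
  -- Freeness allows arbitrary values on the generators, and those dictated by the outer faces are
  -- taken. Inner faces need no correction, as `s` is defined on all of `Δ`.
  let χ : P.FreeCover T →* G := FreeGroup.lift fun a => χ₀ a.1
  have hcross : ∀ a (v w : P.PieceVertex), v.idx = P.src a → w.idx = P.tgt a →
      v.point = w.point → {v.point} ∈ (P.face a).faces →
      s (Quot.mk _ v) = χ (P.crossing T a) • s (Quot.mk _ w) := by
    intro a v w hv hw h hf
    by_cases ha : a ∈ T
    · rw [crossing_of_mem ha, map_one, one_smul]
      exact congrArg s (Quot.sound ⟨a, ha, hv.symm, hw.symm, h, hf⟩)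
    · rw [crossing_of_notMem ha, FreeGroup.lift_apply_of]
      exact hχ₀ a v w hv hw h hf
  obtain ⟨f, hf⟩ := P.exists_descend (T := T) (fun x v => χ x • s (Quot.mk _ v)) (by
    intro a x v w hv hw h hface
    rw [hcross a v w hv hw h hface, map_mul, mul_smul])
  have hf' : ∀ x d, f (P.coverMk T x d) = χ x • s d := by
    intro x d
    induction d using Quot.ind with
    | mk v => exact hf x v
  refine ⟨⟨f, ?_⟩, χ, ?_, hf'⟩
  · rintro _ ⟨x, τ, hτ, rfl⟩
    have := hG.simplicial (χ x) _ (s.map_faces τ hτ)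
    rw [Finset.image_image] at this ⊢
    rwa [show f ∘ P.coverMk T x = (fun w => χ x • w) ∘ s from funext (hf' x)]
  · intro v
    obtain ⟨x, u, rfl⟩ := exists_pieceMk v
    exact (congrArg p (hf x u)).trans ((hG.deck _ _).trans (hs _))

theorem surjective_of_comp_eq_taut (hp : p.IsStarBijective) {f : SimplicialMap (P.cover T) N}
    (hf : ∀ v, p (f v) = P.taut T v) [PreconnectedSpace (Realization N)]
    [Nonempty (P.CoverVertex T)] : Function.Surjective f := by
  intro w
  refine vertex_induction (K := N) (C := Set.range f)
    ⟨Classical.arbitrary (P.CoverVertex T), rfl⟩ ?_ w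
  rintro σ hσ _ hv w hw ⟨v, rfl⟩
  obtain ⟨τ, _, _, rfl⟩ := exists_lift_of_comp_eq_taut hp hf v σ hσ hv
  obtain ⟨u, _, rfl⟩ := Finset.mem_image.1 hw
  exact ⟨u, rfl⟩

theorem isRepresentation_of_comp_eq_taut [Finite V] [Finite I] [Finite A]
    (hT : P.IsArborescent T) (hp : IsUniversalCovering p) {f : SimplicialMap (P.cover T) N}
    (hf : ∀ v, p (f v) = P.taut T v) : IsRepresentation f := by
  have := hp.simplyConnected
  have hgsc := P.isGSC_cover hT
  have := hgsc.pathConnectedSpace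
  have hs := SimplicialMap.isStarBijective_of_isCoveringMap hp.covering
  have hnd : f.NonDegenerate := fun σ hσ v hv w hw h =>
    taut_nonDegenerate σ hσ hv hw (by rw [← hf, ← hf, h])
  have hlift := exists_lift_of_comp_eq_taut hs hf
  refine ⟨P.countable_coverVertex, P.isThreeDimensional_cover, hgsc, hnd,
    SimplicialMap.psi_eq_phi_of_exists_lift hnd hlift, ?_⟩
  have hne : Nonempty (P.CoverVertex T) := by
    obtain ⟨x⟩ := (inferInstance : Nonempty (Realization (P.cover T)))
    exact ⟨x.carrier_nonempty.choose⟩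
  have hsurj : Function.Surjective f.real := by
    intro y
    obtain ⟨w, hw⟩ := y.carrier_nonempty
    obtain ⟨v, rfl⟩ := surjective_of_comp_eq_taut hs hf w
    obtain ⟨τ, hτ, _, e⟩ := hlift v _ y.support_mem hw
    obtain ⟨x, _, hx⟩ := f.exists_real_eq hτ e.symm.subset
    exact ⟨x, hx⟩
  rw [hsurj.range_eq, closure_univ]

/-- If the deck group acts through a homomorphism on the copies of the fundamental domain in a
lift of the tautological map, then the homomorphism is onto. -/
theorem surjective_of_equivariant (hp : IsUniversalCovering p) (hG : IsNaturalAction p e y)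
    (hy : p.real y = b) {s : SimplicialMap (P.domain T) N}
    {f : SimplicialMap (P.cover T) N} {χ : P.FreeCover T →* G} (hf : ∀ v, p (f v) = P.taut T v)
    (hχ : ∀ x d, f (P.coverMk T x d) = χ x • s d) {d : P.DomainVertex T}
    (hd : s d ∈ y.carrier) : Function.Surjective χ := by
  have := hp.simplyConnected
  have hs := SimplicialMap.isStarBijective_of_isCoveringMap hp.covering
  have : Nonempty (P.CoverVertex T) := ⟨P.coverMk T 1 d⟩
  intro g
  induction d using Quot.ind with
  | mk v =>
    obtain ⟨v', hv'⟩ := surjective_of_comp_eq_taut hs hf (g • s (Quot.mk _ v))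
    obtain ⟨x, u, rfl⟩ := exists_pieceMk v'
    have hs1 : p (s (Quot.mk _ v)) = v.point := by
      have h1 := hf (P.pieceMk T 1 v)
      rwa [pieceMk, hχ, map_one, one_smul] at h1
    have hu : u.point = v.point := by
      rw [← hs1, ← hG.deck g, ← hv', hf]
      rfl
    -- The preimage of `g • s v` lies over the same point of `M` as `v`, so it can be moved to the
    -- vertex `v` of some copy `x' Δ`. Then `χ x'` and `g` agree on `s v`, and the action is free
    -- there.
    obtain ⟨x', w, hw, hwu, e'⟩ := P.exists_pieceMk_eq (T := T) x u (hu ▸ v.mem)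
    obtain rfl : w = v := PieceVertex.ext_of hw (hwu.trans hu)
    rw [e', pieceMk, hχ] at hv'
    refine ⟨x', inv_mul_eq_one.1 (hG.eq_one_of_smul_eq hp hy hd ?_)⟩
    rw [mul_smul, ← hv', inv_smul_smul]

end GoodPresentation

end CanonicalLift

end

/-! ### Assembly of the lemma. -/

theorem lemma7 {V I A W G : Type*} [Finite V] [Finite I] [Finite A] [Group G] [MulAction G W]
    (P : GoodPresentation V I A) (T : Set A) (hT : P.IsArborescent T)
    (N : AbstractSimplicialComplex W) (p : SimplicialMap N P.M) (hp : IsUniversalCovering p)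
    (s : SimplicialMap (P.domain T) N) (hs : ∀ d, p (s d) = P.proj T d)
    (b : Realization (P.domain T))
    (e : G ≃* PiOne (Realization P.M) ((P.proj T).real b))
    (hG : IsNaturalAction p e (s.real b)) :
    ∃ f : SimplicialMap (P.cover T) N,
      ((∀ v, p (f v) = P.taut T v) ∧ ∀ d, f (P.coverMk T 1 d) = s d) ∧
      (∀ f' : SimplicialMap (P.cover T) N,
        ((∀ v, p (f' v) = P.taut T v) ∧ ∀ d, f' (P.coverMk T 1 d) = s d) → f' = f) ∧
      IsRepresentation f ∧
      ∃ χ : P.FreeCover T →* G,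
        (∀ y : P.FreeCover T,
          (∃ γ, LiftsTo (P.taut T).real γ ((P.copy T 1).real b) ((P.copy T y).real b) ∧
            loopClass γ = e (χ y)) ∧
          ∀ γ, LiftsTo (P.taut T).real γ ((P.copy T 1).real b) ((P.copy T y).real b) →
            loopClass γ = e (χ y)) ∧
        Function.Surjective χ ∧
        ∀ (y : P.FreeCover T) (v : P.CoverVertex T), f (y • v) = χ y • f v := by
  have := hp.simplyConnected
  have hb : p.real (s.real b) = (P.proj T).real b := s.real_eq_of_comp p _ hs b
  have hsb := SimplicialMap.isStarBijective_of_isCoveringMap hp.covering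
  obtain ⟨f, χ, hf, hχ⟩ := P.exists_equivariant_lift hp hG hb hs
  have hf1 : ∀ d, f (P.coverMk T 1 d) = s d := fun d => by rw [hχ, map_one, one_smul]
  have hrep := P.isRepresentation_of_comp_eq_taut hT hp hf
  have hconn := hrep.gsc.pathConnectedSpace
  obtain ⟨d₀, hd₀⟩ := b.carrier_nonempty
  have htaut : ∀ y, (P.taut T).real ((P.copy T y).real b) = (P.proj T).real b := fun y =>
    (P.copy T y).real_eq_of_comp (P.taut T) _ (fun d => rfl) b
  have hclass : ∀ y γ, LiftsTo (P.taut T).real γ ((P.copy T 1).real b) ((P.copy T y).real b) →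
      loopClass γ = e (χ y) := by
    rintro y γ ⟨δ, hδ⟩
    obtain ⟨γ', hγ'⟩ := exists_loopClass_eq (e (χ y))
    have h1 : f.real ((P.copy T 1).real b) = s.real b :=
      (P.copy T 1).real_eq_of_comp f _ hf1 b
    have h2 : f.real ((P.copy T y).real b) = (actionMap hG.simplicial (χ y)).real (s.real b) :=
      (P.copy T y).real_eq_real f s (actionMap hG.simplicial (χ y)) (fun d => hχ y d) b
    rw [← hγ']
    -- The path `f ∘ δ` and the monodromy lift of `γ'` have the same ends in the universal covering.
    refine loopClass_eq_of_liftsTo hp.covering.continuous ?_ (hG.monodromy (χ y) γ' hγ')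
    exact ⟨(δ.map f.continuous_real).cast h1.symm h2.symm, fun t =>
      (f.real_eq_of_comp p _ hf (δ t)).trans (hδ t)⟩
  refine ⟨f, ⟨hf, hf1⟩, ?_, hrep, χ, fun y => ⟨?_, hclass y⟩, ?_, ?_⟩
  · rintro f' ⟨hf', hf1'⟩
    exact hsb.eq_of_lift (fun v => (hf' v).trans (hf v).symm)
      (v₀ := P.coverMk T 1 d₀) ((hf1' d₀).trans (hf1 d₀).symm)
  · obtain ⟨δ⟩ := PathConnectedSpace.joined ((P.copy T 1).real b) ((P.copy T y).real b)
    have hγ : LiftsTo (P.taut T).real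
        ((δ.map (P.taut T).continuous_real).cast (htaut 1).symm (htaut y).symm)
        ((P.copy T 1).real b) ((P.copy T y).real b) := ⟨δ, fun t => rfl⟩
    exact ⟨_, hγ, hclass y _ hγ⟩
  · refine P.surjective_of_equivariant hp hG hb hf hχ (d := d₀) ?_
    classical
    rw [SimplicialMap.carrier_real]
    exact Finset.mem_image_of_mem _ hd₀
  · intro y v
    obtain ⟨x, u, rfl⟩ := GoodPresentation.exists_pieceMk v
    change f (P.coverMk T (y * x) (Quot.mk _ u)) = χ y • f (P.coverMk T x (Quot.mk _ u))
    rw [hχ, hχ, map_mul, mul_smul]
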